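/- Let $K$ be a field of characteristic $0$, let $L_6$ be the free Lie algebra over $K$ on $x_1,\dots,x_6$, and let $L_6/L_6''$ be the free metabelian Lie algebra (its generators are again denoted $x_1,\dots,x_6$). Its commutator ideal $L_6'/L_6''$ is a $K[X_6]$-module, $K[X_6]=K[x_1,\dots,x_6]$, via $u\,f(x_1,\dots,x_6)=u\,f(\mathrm{ad}\,x_1,\dots,\mathrm{ad}\,x_6)$, where $u\,\mathrm{ad}\,x_i=[u,x_i]$; commutators are left normed, $[x,y,z]=[[x,y],z]$. Let $\delta=\delta(1,1,1)$ be the derivation, both of $K[X_6]$ and of $L_6/L_6''$, with $$\delta(x_1)=\delta(x_3)=\delta(x_5)=0,\quad \delta(x_2)=x_1,\ \delta(x_4)=x_3,\ \delta(x_6)=x_5,$$ and let the superscript $\delta$ denote the kernel of $\delta$. Put $$f_1=x_1,\ f_2=x_3,\ f_3=x_5,\ f_4=x_1x_4-x_2x_3,\ f_5=x_1x_6-x_2x_5,\ f_6=x_3x_6-x_4x_5,$$ $$c_1=[x_3,x_1],\ c_2=[x_5,x_1],\ c_3=[x_5,x_3],\ c_4=[x_2,x_1],\ c_5=[x_4,x_3],\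 c_6=[x_6,x_5],$$ $$c_7=[x_4,x_1]-[x_3,x_2],\ c_8=[x_6,x_1]-[x_5,x_2],\ c_9=[x_6,x_3]-[x_5,x_4],$$ $$c_{10}=[x_3,x_2,x_5]-[x_5,x_2,x_3]-[x_4,x_1,x_5]+[x_5,x_1,x_4].$$ (1) The algebra $K[X_6]^\delta$ is generated by $f_1,\dots,f_6$, the ideal of relations between them is generated by the single relation $f_1f_6-f_2f_5+f_3f_4=0$, and $K[X_6]^\delta$ has the $K$-basis $$f_1^{q_1}f_2^{q_2}f_3^{q_3}f_4^{q_4}f_6^{q_6},\qquad f_1^{q_1}f_3^{q_3}f_4^{q_4}f_5^{q_5+1}f_6^{q_6}\qquad(q_i\ge 0).$$ (2) The $K[X_6]^\delta$-module $(L_6'/L_6'')^\delta$ is generated by $c_1,\dots,c_{10}$. (3) The following 21 relations hold: $$c_3f_1=-c_1f_3+c_2f_2,$$ $$c_1f_4=-c_4f_2^2-c_5f_1^2+c_7f_1f_2,$$ $$c_1f_5=-c_2f_4-2c_4f_2f_3+c_7f_1f_3+c_8f_1f_2-c_9f_1^2,$$ $$c_3f_4=-c_1f_6+2c_5f_1f_3-c_7f_2f_3+c_8f_2^2-c_9f_1f_2,$$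 $$c_3f_5=-c_2f_6-2c_6f_1f_2-c_7f_3^2+c_8f_2f_3+c_9f_1f_3,$$ $$c_3f_6=-c_5f_3^2-c_6f_2^2+c_9f_2f_3,$$ $$c_2f_5=-c_4f_3^2-c_6f_1^2+c_8f_1f_3,$$ $$c_{10}f_1=-c_1f_5-c_4f_2f_3+c_8f_1f_2-c_9f_1^2,$$ $$c_{10}f_2=-c_1f_6+c_5f_1f_3-c_7f_2f_3+c_8f_2^2-c_9f_1f_2,$$ $$c_{10}f_3=-c_2f_6-c_6f_1f_2-c_7f_3^2+c_8f_2f_3,$$ $$c_1f_1f_6=-c_2f_2f_4-c_4f_2^2f_3+c_5f_1^2f_3+c_8f_1f_2^2-c_9f_1^2f_2,$$ $$c_1f_3f_6=c_2f_2f_6+c_5f_1f_3^2+c_6f_1f_2^2-c_9f_1f_2f_3,$$ $$c_2f_1f_6=-c_2f_3f_4-c_4f_2f_3^2-c_6f_1^2f_2+c_8f_1f_2f_3,$$ $$c_{10}f_4=c_4f_2f_6+c_5f_1f_5-c_7(f_1f_6+f_3f_4)+c_8f_2f_4-c_9f_1f_4,$$ $$c_{10}f_5=c_4f_3f_6-c_6f_1f_4-c_7f_3f_5+c_8f_3f_4,$$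 $$c_{10}f_6=-c_5f_3f_5-c_6f_2f_4+c_9f_3f_4,$$ $$c_1f_6^2=c_5f_3(f_3f_4+2f_1f_6)+c_6f_2^2f_4-c_7f_2f_3f_6+c_8f_2^2f_6-c_9f_2(f_3f_4+f_1f_6),$$ $$c_2f_4^2=c_4f_2(-f_3f_4+f_1f_6)+c_5f_1^2f_5-c_7f_1^2f_6+c_8f_1f_2f_4-c_9f_1^2f_4,$$ $$c_2f_4f_6=-c_4f_2f_3f_6-c_5f_1f_3f_5-c_6f_1f_2f_4+c_7f_1f_3f_6+c_9f_1f_3f_4,$$ $$c_2f_6^2=c_5f_3^2f_5+c_6f_2(f_3f_4-f_1f_6)-c_7f_3^2f_6+c_8f_2f_3f_6-c_9f_3^2f_4,$$ $$c_4f_6^2=-c_5f_5^2-c_6f_4^2+c_7f_5f_6-c_8f_4f_6+c_9f_4f_5.$$ (4) The following elements form a basis of the $K$-vector space $(L_6'/L_6'')^\delta$: $$c_1f_1^{q_1}f_2^{q_2}f_3^{q_3},\quad c_1f_2^{q_2}f_6,\quad c_2f_1^{q_1}f_2^{q_2}f_3^{q_3}f_4^{\varepsilon},\quad c_2f_2^{q_2}f_3^{q_3}f_6,\quad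 c_3f_2^{q_2}f_3^{q_3},$$ $$c_4f_1^{q_1}f_2^{q_2}f_3^{q_3}f_4^{q_4}f_6^{\varepsilon},\quad c_4f_1^{q_1}f_3^{q_3}f_4^{q_4}f_5^{q_5+1}f_6^{\varepsilon},$$ $$c_jf_1^{q_1}f_2^{q_2}f_3^{q_3}f_4^{q_4}f_6^{q_6},\quad c_jf_1^{q_1}f_3^{q_3}f_4^{q_4}f_5^{q_5+1}f_6^{q_6}\quad(5\le j\le 9),\quad c_{10},$$ where $q_i\ge 0$ and $\varepsilon\in\{0,1\}$ (different indices give different basis elements). -/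

import Mathlib

open MvPolynomial

noncomputable section

namespace FreeMetab

/-! ### Free metabelian Lie algebras -/

/-- The free metabelian Lie algebra `L_d / L_d''` over `K` on `d` generators, where `L_d` is the free
Lie algebra and `L_d''` is the second term of its derived series. -/
abbrev FM (K : Type*) [Field K] (d : ℕ) : Type _ :=
  FreeLieAlgebra K (Fin d) ⧸ LieAlgebra.derivedSeries K (FreeLieAlgebra K (Fin d)) 2

/-- The free generators of `L_d / L_d''` (indexed from `0`). -/
def gen (K : Type*) [Field K] {d : ℕ} (i : Fin d) : FM K d :=
  LieSubmodule.Quotient.mk (FreeLieAlgebra.of K i)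

/-- The commutator ideal `L_d' / L_d''` of `L_d / L_d''`. -/
abbrev Comm (K : Type*) [Field K] (d : ℕ) : Type _ :=
  ↥(LieAlgebra.derivedSeries K (FM K d) 1)

theorem lie_mem_derived {K : Type*} [Field K] {L : Type*} [LieRing L] [LieAlgebra K L]
    (a b : L) : ⁅a, b⁆ ∈ LieAlgebra.derivedSeries K L 1 := by
  rw [LieAlgebra.derivedSeries_def, LieAlgebra.derivedSeriesOfIdeal_succ,
    LieAlgebra.derivedSeriesOfIdeal_zero]
  exact LieSubmodule.lie_mem_lie (LieSubmodule.mem_top _) (LieSubmodule.mem_top _)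

theorem lie_mem_comm {K : Type*} [Field K] {d : ℕ} (a b : FM K d) :
    ⁅a, b⁆ ∈ LieAlgebra.derivedSeries K (FM K d) 1 :=
  lie_mem_derived a b

theorem derivation_mem_derived {K : Type*} [Field K] {L : Type*} [LieRing L] [LieAlgebra K L]
    (D : LieDerivation K L L) {u : L} (hu : u ∈ LieAlgebra.derivedSeries K L 1) :
    D u ∈ LieAlgebra.derivedSeries K L 1 := by
  rw [LieAlgebra.derivedSeries_def, LieAlgebra.derivedSeriesOfIdeal_succ,
    LieAlgebra.derivedSeriesOfIdeal_zero, ← LieSubmodule.mem_toSubmodule,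
    LieSubmodule.lieIdeal_oper_eq_linear_span'] at hu
  induction hu using Submodule.span_induction with
  | zero => simp
  | add x y _ _ hx hy => rw [map_add]; exact add_mem hx hy
  | smul t x _ hx => rw [map_smul]; exact Submodule.smul_mem _ t hx
  | mem x hx =>
    obtain ⟨a, -, b, -, rfl⟩ := hx
    rw [LieDerivation.apply_lie_eq_add]
    exact add_mem (lie_mem_derived _ _) (lie_mem_derived _ _)

theorem lie_lie_lie_mem {K : Type*} [Field K] {L : Type*} [LieRing L] [LieAlgebra K L]
    (a b c e : L) : ⁅⁅a, b⁆, ⁅c, e⁆⁆ ∈ LieAlgebra.derivedSeries K L 2 := by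
  rw [LieAlgebra.derivedSeries_def, LieAlgebra.derivedSeriesOfIdeal_succ,
    LieAlgebra.derivedSeriesOfIdeal_succ, LieAlgebra.derivedSeriesOfIdeal_zero]
  exact LieSubmodule.lie_mem_lie
    (LieSubmodule.lie_mem_lie (LieSubmodule.mem_top _) (LieSubmodule.mem_top _))
    (LieSubmodule.lie_mem_lie (LieSubmodule.mem_top _) (LieSubmodule.mem_top _))

/-- The metabelian identity holds in `L_d / L_d''`. -/
theorem metabelian {K : Type*} [Field K] {d : ℕ} (a b c e : FM K d) :
    ⁅⁅a, b⁆, ⁅c, e⁆⁆ = 0 := by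
  obtain ⟨a, rfl⟩ := LieSubmodule.Quotient.surjective_mk' _ a
  obtain ⟨b, rfl⟩ := LieSubmodule.Quotient.surjective_mk' _ b
  obtain ⟨c, rfl⟩ := LieSubmodule.Quotient.surjective_mk' _ c
  obtain ⟨e, rfl⟩ := LieSubmodule.Quotient.surjective_mk' _ e
  exact (LieSubmodule.Quotient.mk_eq_zero (N := LieAlgebra.derivedSeries K _ 2)).2
    (lie_lie_lie_mem (K := K) a b c e)

/-- In a metabelian Lie algebra brackets of elements of the derived ideal vanish. -/
theorem lie_eq_zero_of_mem {K : Type*} [Field K] {L : Type*} [LieRing L] [LieAlgebra K L]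
    (h : ∀ a b c e : L, ⁅⁅a, b⁆, ⁅c, e⁆⁆ = 0) {u v : L}
    (hu : u ∈ LieAlgebra.derivedSeries K L 1) (hv : v ∈ LieAlgebra.derivedSeries K L 1) :
    ⁅u, v⁆ = 0 := by
  rw [LieAlgebra.derivedSeries_def, LieAlgebra.derivedSeriesOfIdeal_succ,
    LieAlgebra.derivedSeriesOfIdeal_zero, ← LieSubmodule.mem_toSubmodule,
    LieSubmodule.lieIdeal_oper_eq_linear_span'] at hu hv
  induction hu using Submodule.span_induction with
  | zero => simp
  | add x y _ _ hx hy => rw [add_lie, hx, hy, add_zero]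
  | smul t x _ hx => rw [smul_lie, hx, smul_zero]
  | mem x hx =>
    obtain ⟨a, -, b, -, rfl⟩ := hx
    induction hv using Submodule.span_induction with
    | zero => simp
    | add x y _ _ hx hy => rw [lie_add, hx, hy, add_zero]
    | smul t x _ hx => rw [lie_smul, hx, smul_zero]
    | mem y hy =>
      obtain ⟨c, -, e, -, rfl⟩ := hy
      exact h a b c e

theorem derivedSeries_two_eq_bot {K : Type*} [Field K] {L : Type*} [LieRing L] [LieAlgebra K L]
    (h : ∀ a b c e : L, ⁅⁅a, b⁆, ⁅c, e⁆⁆ = 0) : LieAlgebra.derivedSeries K L 2 = ⊥ := by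
  have h2 : LieAlgebra.derivedSeries K L 2
      = ⁅LieAlgebra.derivedSeries K L 1, LieAlgebra.derivedSeries K L 1⁆ := rfl
  rw [h2, LieSubmodule.lie_eq_bot_iff]
  exact fun u hu v hv => lie_eq_zero_of_mem h hu hv

/-! ### The `K[X_d]`-module structure of the commutator ideal -/

/-- The right multiplication `u ↦ [u, x_i]`, i.e. `u ↦ u (ad x_i)`, on `L_d' / L_d''`. -/
def adR (K : Type*) [Field K] {d : ℕ} (i : Fin d) : Module.End K (Comm K d) where
  toFun u := ⟨⁅(u : FM K d), gen K i⁆, lie_mem_comm _ _⟩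
  map_add' u v := by ext; simp
  map_smul' t u := by ext; simp

theorem adR_comm {K : Type*} [Field K] {d : ℕ} (i j : Fin d) :
    adR K i * adR K j = adR K j * adR K i := by
  ext u
  change ⁅⁅(u : FM K d), gen K j⁆, gen K i⁆ = ⁅⁅(u : FM K d), gen K i⁆, gen K j⁆
  have h0 : ⁅(u : FM K d), ⁅(gen K j : FM K d), gen K i⁆⁆ = 0 :=
    lie_eq_zero_of_mem (K := K) metabelian u.2 (lie_mem_comm _ _)
  rw [leibniz_lie, add_eq_zero_iff_eq_neg, lie_skew] at h0
  exact h0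

/-- The commutative algebra of operators on `L_d' / L_d''` generated by the `ad x_i`. -/
def opAlg (K : Type*) [Field K] (d : ℕ) : Subalgebra K (Module.End K (Comm K d)) :=
  Algebra.adjoin K (Set.range (adR K (d := d)))

instance (K : Type*) [Field K] (d : ℕ) : IsMulCommutative (opAlg K d) :=
  Algebra.isMulCommutative_adjoin K (by
    rintro _ ⟨i, rfl⟩ _ ⟨j, rfl⟩
    exact adR_comm i j)

open scoped IsMulCommutative in
/-- The substitution `f ↦ f(ad x_1, …, ad x_d)`. -/
def polyAct (K : Type*) [Field K] (d : ℕ) :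
    MvPolynomial (Fin d) K →ₐ[K] Module.End K (Comm K d) :=
  (opAlg K d).val.comp
    (aeval fun i => (⟨adR K i, Algebra.subset_adjoin ⟨i, rfl⟩⟩ : opAlg K d))

@[simp] theorem polyAct_X {K : Type*} [Field K] {d : ℕ} (i : Fin d) :
    polyAct K d (X i) = adR K i := by
  simp [polyAct]

/-- The `K[X_d]`-module structure `u f(x_1, …, x_d) = u f(ad x_1, …, ad x_d)` on `L_d' / L_d''`. -/
instance (K : Type*) [Field K] (d : ℕ) : Module (MvPolynomial (Fin d) K) (Comm K d) :=
  Module.compHom (Comm K d) (polyAct K d).toRingHom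

theorem poly_smul_def {K : Type*} [Field K] {d : ℕ} (f : MvPolynomial (Fin d) K) (u : Comm K d) :
    f • u = polyAct K d f u := rfl

@[simp] theorem coe_X_smul {K : Type*} [Field K] {d : ℕ} (i : Fin d) (u : Comm K d) :
    ((X i : MvPolynomial (Fin d) K) • u : Comm K d) = ⁅(u : FM K d), gen K i⁆ := by
  rw [poly_smul_def, polyAct_X]; rfl

instance (K : Type*) [Field K] (d : ℕ) :
    IsScalarTower K (MvPolynomial (Fin d) K) (Comm K d) where
  smul_assoc t f u := by simp [poly_smul_def]

/-! ### Weitzenböck derivations -/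

/-- The Lie algebra `L ⊕ ε L`, `ε ^ 2 = 0`; it is used to extend maps to derivations. -/
def Eps (L : Type*) : Type _ := L × L

/-- The element `a + ε b`. -/
def Eps.mk {L : Type*} (a b : L) : Eps L := (a, b)

instance (L : Type*) [LieRing L] : AddCommGroup (Eps L) := inferInstanceAs (AddCommGroup (L × L))

instance (K : Type*) [Field K] (L : Type*) [LieRing L] [LieAlgebra K L] : Module K (Eps L) :=
  inferInstanceAs (Module K (L × L))

instance (L : Type*) [LieRing L] : LieRing (Eps L) where
  bracket u v := (⁅u.1, v.1⁆, ⁅u.1, v.2⁆ + ⁅u.2, v.1⁆)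
  add_lie u v w := Prod.ext (add_lie u.1 v.1 w.1) (by
    change ⁅u.1 + v.1, w.2⁆ + ⁅u.2 + v.2, w.1⁆ = (⁅u.1, w.2⁆ + ⁅u.2, w.1⁆) + (⁅v.1, w.2⁆ + ⁅v.2, w.1⁆)
    rw [add_lie, add_lie]; abel)
  lie_add u v w := Prod.ext (lie_add u.1 v.1 w.1) (by
    change ⁅u.1, v.2 + w.2⁆ + ⁅u.2, v.1 + w.1⁆ = (⁅u.1, v.2⁆ + ⁅u.2, v.1⁆) + (⁅u.1, w.2⁆ + ⁅u.2, w.1⁆)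
    rw [lie_add, lie_add]; abel)
  lie_self u := Prod.ext (lie_self u.1) (by
    change ⁅u.1, u.2⁆ + ⁅u.2, u.1⁆ = 0
    rw [← lie_skew, neg_add_cancel])
  leibniz_lie u v w := Prod.ext (leibniz_lie u.1 v.1 w.1) (by
    change ⁅u.1, ⁅v.1, w.2⁆ + ⁅v.2, w.1⁆⁆ + ⁅u.2, ⁅v.1, w.1⁆⁆
      = (⁅⁅u.1, v.1⁆, w.2⁆ + ⁅⁅u.1, v.2⁆ + ⁅u.2, v.1⁆, w.1⁆)
        + (⁅v.1, ⁅u.1, w.2⁆ + ⁅u.2, w.1⁆⁆ + ⁅v.2, ⁅u.1, w.1⁆⁆)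
    rw [lie_add, add_lie, lie_add, leibniz_lie u.1 v.1 w.2, leibniz_lie u.1 v.2 w.1,
      leibniz_lie u.2 v.1 w.1]
    abel)

theorem Eps.lie_def {L : Type*} [LieRing L] (u v : Eps L) :
    ⁅u, v⁆ = ((⁅u.1, v.1⁆, ⁅u.1, v.2⁆ + ⁅u.2, v.1⁆) : L × L) := rfl

instance (K : Type*) [Field K] (L : Type*) [LieRing L] [LieAlgebra K L] : LieAlgebra K (Eps L) where
  lie_smul t u v := Prod.ext (lie_smul t u.1 v.1) (by
    change ⁅u.1, t • v.2⁆ + ⁅u.2, t • v.1⁆ = t • (⁅u.1, v.2⁆ + ⁅u.2, v.1⁆)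
    rw [lie_smul, lie_smul, smul_add])

theorem Eps.metabelian {L : Type*} [LieRing L]
    (h : ∀ a b c e : L, ⁅⁅a, b⁆, ⁅c, e⁆⁆ = 0) (a b c e : Eps L) : ⁅⁅a, b⁆, ⁅c, e⁆⁆ = 0 := by
  refine Prod.ext (h _ _ _ _) ?_
  change ⁅⁅a.1, b.1⁆, ⁅c.1, e.2⁆ + ⁅c.2, e.1⁆⁆ + ⁅⁅a.1, b.2⁆ + ⁅a.2, b.1⁆, ⁅c.1, e.1⁆⁆ = 0
  simp [lie_add, add_lie, h]

/-- The homomorphism `L_d → (L_d/L_d'') ⊕ ε (L_d/L_d'')` with `x_i ↦ x_i + ε g_i`. -/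
def epsLift (K : Type*) [Field K] {d : ℕ} (g : Fin d → FM K d) :
    FreeLieAlgebra K (Fin d) →ₗ⁅K⁆ Eps (FM K d) :=
  FreeLieAlgebra.lift K fun i => Eps.mk (gen K i) (g i)

theorem epsLift_of {K : Type*} [Field K] {d : ℕ} (g : Fin d → FM K d) (i : Fin d) :
    epsLift K g (FreeLieAlgebra.of K i) = Eps.mk (gen K i) (g i) :=
  FreeLieAlgebra.lift_of_apply _ _

theorem epsLift_eq_zero {K : Type*} [Field K] {d : ℕ} (g : Fin d → FM K d)
    {w : FreeLieAlgebra K (Fin d)}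
    (hw : w ∈ LieAlgebra.derivedSeries K (FreeLieAlgebra K (Fin d)) 2) : epsLift K g w = 0 := by
  have h := LieIdeal.derivedSeries_map_le (f := epsLift K g) 2
  rw [derivedSeries_two_eq_bot (Eps.metabelian metabelian)] at h
  simpa using h (LieIdeal.mem_map hw)

theorem epsLift_fst {K : Type*} [Field K] {d : ℕ} (g : Fin d → FM K d)
    (w : FreeLieAlgebra K (Fin d)) :
    (epsLift K g w).1 = (LieSubmodule.Quotient.mk w : FM K d) := by
  let p : FreeLieAlgebra K (Fin d) →ₗ⁅K⁆ FM K d :=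
    { toFun := fun w => (epsLift K g w).1
      map_add' := fun a b => by rw [map_add]; rfl
      map_smul' := fun t a => by rw [map_smul]; rfl
      map_lie' := fun {a b} => by rw [LieHom.map_lie]; rfl }
  let q : FreeLieAlgebra K (Fin d) →ₗ⁅K⁆ FM K d :=
    { toFun := fun w => (LieSubmodule.Quotient.mk w : FM K d)
      map_add' := fun a b => rfl
      map_smul' := fun t a => rfl
      map_lie' := fun {a b} => LieSubmodule.Quotient.mk_bracket _ a b }
  have hpq : p = q := by
    refine FreeLieAlgebra.hom_ext fun i => ?_
    exact congrArg Prod.fst (epsLift_of g i)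
  exact congrArg (fun r : FreeLieAlgebra K (Fin d) →ₗ⁅K⁆ FM K d => r w) hpq

/-- The derivation of `L_d / L_d''` that extends the map `x_i ↦ g_i`. -/
def lieDer (K : Type*) [Field K] {d : ℕ} (g : Fin d → FM K d) :
    LieDerivation K (FM K d) (FM K d) where
  toFun := Submodule.liftQ
    (LieAlgebra.derivedSeries K (FreeLieAlgebra K (Fin d)) 2).toSubmodule
    ({ toFun := fun w => (epsLift K g w).2
       map_add' := fun a b => by rw [map_add]; rfl
       map_smul' := fun t a => by rw [map_smul]; rfl } :
      FreeLieAlgebra K (Fin d) →ₗ[K] FM K d)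
    (fun w hw => by
      change (epsLift K g w).2 = 0
      rw [epsLift_eq_zero g hw]; rfl)
  map_add' := map_add _
  map_smul' := map_smul _
  leibniz' a b := by
    obtain ⟨a, rfl⟩ := LieSubmodule.Quotient.surjective_mk' _ a
    obtain ⟨b, rfl⟩ := LieSubmodule.Quotient.surjective_mk' _ b
    change (epsLift K g ⁅a, b⁆).2
      = ⁅(LieSubmodule.Quotient.mk a : FM K d), (epsLift K g b).2⁆
        - ⁅(LieSubmodule.Quotient.mk b : FM K d), (epsLift K g a).2⁆
    rw [LieHom.map_lie, Eps.lie_def, epsLift_fst, epsLift_fst,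
      ← lie_skew (epsLift K g a).2 (LieSubmodule.Quotient.mk b : FM K d), sub_eq_add_neg]

@[simp] theorem lieDer_gen {K : Type*} [Field K] {d : ℕ} (g : Fin d → FM K d) (i : Fin d) :
    lieDer K g (gen K i) = g i := by
  exact congrArg Prod.snd (epsLift_of g i)

/-- The derivation of `K[X_d]` with `δ(x_j) = ∑ i, A i j x_i`. -/
def polyDelta {K : Type*} [Field K] {d : ℕ} (A : Matrix (Fin d) (Fin d) K) :
    Derivation K (MvPolynomial (Fin d) K) (MvPolynomial (Fin d) K) :=
  mkDerivation K fun j => ∑ i, A i j • X i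

/-- The derivation of `L_d / L_d''` with `δ(x_j) = ∑ i, A i j x_i`. -/
def lieDelta {K : Type*} [Field K] {d : ℕ} (A : Matrix (Fin d) (Fin d) K) :
    LieDerivation K (FM K d) (FM K d) :=
  lieDer K fun j => ∑ i, A i j • gen K i

theorem lieDelta_mem {K : Type*} [Field K] {d : ℕ} (A : Matrix (Fin d) (Fin d) K) (u : Comm K d) :
    lieDelta A (u : FM K d) ∈ LieAlgebra.derivedSeries K (FM K d) 1 :=
  derivation_mem_derived _ u.2

/-- The restriction of `δ` to the commutator ideal `L_d' / L_d''`. -/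
def commDelta {K : Type*} [Field K] {d : ℕ} (A : Matrix (Fin d) (Fin d) K) :
    Comm K d →ₗ[K] Comm K d where
  toFun u := ⟨lieDelta A (u : FM K d), lieDelta_mem A u⟩
  map_add' u v := by ext; simp
  map_smul' t u := by ext; simp

@[simp] theorem coe_commDelta {K : Type*} [Field K] {d : ℕ} (A : Matrix (Fin d) (Fin d) K)
    (u : Comm K d) : (commDelta A u : FM K d) = lieDelta A (u : FM K d) := rfl

theorem C_smul_comm {K : Type*} [Field K] {d : ℕ} (t : K) (u : Comm K d) :
    (C t : MvPolynomial (Fin d) K) • u = t • u := by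
  rw [← mul_one (C t), ← smul_eq_C_mul, smul_assoc, one_smul]

theorem gen_sum_smul {K : Type*} [Field K] {d : ℕ} (a : Fin d → K) (u : Comm K d) :
    (((∑ i, a i • X i : MvPolynomial (Fin d) K) • u : Comm K d) : FM K d)
      = ⁅(u : FM K d), ∑ i, a i • gen K i⁆ := by
  have h : ∀ s : Finset (Fin d),
      (((∑ i ∈ s, a i • X i : MvPolynomial (Fin d) K) • u : Comm K d) : FM K d)
        = ⁅(u : FM K d), ∑ i ∈ s, a i • gen K i⁆ := by
    intro s
    induction s using Finset.induction_on with
    | empty => simp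
    | insert i s hi ih =>
      rw [Finset.sum_insert hi, Finset.sum_insert hi, add_smul, lie_add, smul_assoc, lie_smul]
      change _ + _ = _
      rw [← ih, ← coe_X_smul]
      rfl
  exact h Finset.univ

/-- The product rule `δ(u f) = δ(u) f + u δ(f)` for `u ∈ L_d' / L_d''` and `f ∈ K[X_d]`. -/
theorem commDelta_smul {K : Type*} [Field K] {d : ℕ} (A : Matrix (Fin d) (Fin d) K)
    (f : MvPolynomial (Fin d) K) (u : Comm K d) :
    commDelta A (f • u) = f • commDelta A u + polyDelta A f • u := by
  induction f using MvPolynomial.induction_on generalizing u with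
  | C t =>
    have : polyDelta A (C t) = 0 := by
      rw [← algebraMap_eq]; exact Derivation.map_algebraMap _ _
    rw [C_smul_comm, C_smul_comm, map_smul, this, zero_smul, add_zero]
  | add p q hp hq => rw [add_smul, map_add, hp, hq, map_add, add_smul, add_smul]; abel
  | mul_X p i hp =>
    have hX : commDelta A ((X i : MvPolynomial (Fin d) K) • u)
        = (X i : MvPolynomial (Fin d) K) • commDelta A u
          + polyDelta A (X i : MvPolynomial (Fin d) K) • u := by
      have h1 : polyDelta A (X i : MvPolynomial (Fin d) K) = ∑ j, A j i • X j :=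
        mkDerivation_X _ _ _
      apply Subtype.ext
      rw [h1]
      change lieDelta A (((X i : MvPolynomial (Fin d) K) • u : Comm K d) : FM K d) =
        (((X i : MvPolynomial (Fin d) K) • commDelta A u : Comm K d) : FM K d)
        + (((∑ j, A j i • X j : MvPolynomial (Fin d) K) • u : Comm K d) : FM K d)
      rw [coe_X_smul, coe_X_smul, gen_sum_smul, LieDerivation.apply_lie_eq_add, coe_commDelta,
        lieDelta, lieDer_gen, add_comm]
    rw [mul_smul, hp, hX, Derivation.leibniz, smul_add, add_smul, mul_smul, smul_smul, smul_smul,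
      smul_eq_mul, smul_eq_mul, mul_comm (X i) (polyDelta A p), add_assoc, mul_smul (polyDelta A p)]

/-- The algebra of constants `K[X_d]^δ`. -/
def polyConst {K : Type*} [Field K] {d : ℕ} (A : Matrix (Fin d) (Fin d) K) :
    Subalgebra K (MvPolynomial (Fin d) K) where
  carrier := {f | polyDelta A f = 0}
  add_mem' {f g} hf hg := by
    simp only [Set.mem_ofPred_eq] at *
    rw [map_add, hf, hg, add_zero]
  mul_mem' {f g} hf hg := by
    simp only [Set.mem_ofPred_eq] at *
    rw [Derivation.leibniz, hf, hg, smul_zero, smul_zero, add_zero]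
  algebraMap_mem' t := Derivation.map_algebraMap _ t

/-- The `K[X_d]^δ`-module of constants `(L_d' / L_d'')^δ`. -/
def commConst {K : Type*} [Field K] {d : ℕ} (A : Matrix (Fin d) (Fin d) K) :
    Submodule (polyConst A) (Comm K d) where
  carrier := {u | commDelta A u = 0}
  zero_mem' := map_zero _
  add_mem' {u v} hu hv := by
    simp only [Set.mem_ofPred_eq] at *
    rw [map_add, hu, hv, add_zero]
  smul_mem' f u hu := by
    have hf : polyDelta A (f : MvPolynomial (Fin d) K) = 0 := f.2
    simp only [Set.mem_ofPred_eq] at *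
    change commDelta A ((f : MvPolynomial (Fin d) K) • u) = 0
    rw [commDelta_smul, hu, hf, smul_zero, zero_smul, add_zero]

/-! ### The derivation `δ(1,1,1)` -/

/-- The matrix of `δ(1,1,1)`: three Jordan cells of size `2`, so that `δ(x₂) = x₁`, `δ(x₄) = x₃`,
`δ(x₆) = x₅` and `δ(x₁) = δ(x₃) = δ(x₅) = 0`. -/
def J222 (K : Type*) [Field K] : Matrix (Fin 6) (Fin 6) K :=
  !![0, 1, 0, 0, 0, 0;
     0, 0, 0, 0, 0, 0;
     0, 0, 0, 1, 0, 0;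
     0, 0, 0, 0, 0, 0;
     0, 0, 0, 0, 0, 1;
     0, 0, 0, 0, 0, 0]

section Elements

variable (K : Type*) [Field K]

/-- The left normed commutator `[x_i, x_j]`, with generators numbered `0, …, 5`. -/
def br (i j : Fin 6) : Comm K 6 := ⟨⁅gen K i, gen K j⁆, lie_mem_comm _ _⟩

/-- The left normed commutator `[x_i, x_j, x_k] = [[x_i, x_j], x_k]`. -/
def br3 (i j k : Fin 6) : Comm K 6 := ⟨⁅⁅gen K i, gen K j⁆, gen K k⁆, lie_mem_comm _ _⟩

/-- `x₁` -/
def f1 : MvPolynomial (Fin 6) K := X 0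
/-- `x₃` -/
def f2 : MvPolynomial (Fin 6) K := X 2
/-- `x₅` -/
def f3 : MvPolynomial (Fin 6) K := X 4
/-- `x₁x₄ - x₂x₃` -/
def f4 : MvPolynomial (Fin 6) K := X 0 * X 3 - X 1 * X 2
/-- `x₁x₆ - x₂x₅` -/
def f5 : MvPolynomial (Fin 6) K := X 0 * X 5 - X 1 * X 4
/-- `x₃x₆ - x₄x₅` -/
def f6 : MvPolynomial (Fin 6) K := X 2 * X 5 - X 3 * X 4

/-- `[x₃, x₁]` -/
def c1 : Comm K 6 := br K 2 0
/-- `[x₅, x₁]` -/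
def c2 : Comm K 6 := br K 4 0
/-- `[x₅, x₃]` -/
def c3 : Comm K 6 := br K 4 2
/-- `[x₂, x₁]` -/
def c4 : Comm K 6 := br K 1 0
/-- `[x₄, x₃]` -/
def c5 : Comm K 6 := br K 3 2
/-- `[x₆, x₅]` -/
def c6 : Comm K 6 := br K 5 4
/-- `[x₄, x₁] - [x₃, x₂]` -/
def c7 : Comm K 6 := br K 3 0 - br K 2 1
/-- `[x₆, x₁] - [x₅, x₂]` -/
def c8 : Comm K 6 := br K 5 0 - br K 4 1
/-- `[x₆, x₃] - [x₅, x₄]` -/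
def c9 : Comm K 6 := br K 5 2 - br K 4 3
/-- `[x₃, x₂, x₅] - [x₅, x₂, x₃] - [x₄, x₁, x₅] + [x₅, x₁, x₄]` -/
def c10 : Comm K 6 := br3 K 2 1 4 - br3 K 4 1 2 - br3 K 3 0 4 + br3 K 4 0 3

/-- The elements `c₅, c₆, c₇, c₈, c₉`. -/
def c5to9 : Fin 5 → Comm K 6 := ![c5 K, c6 K, c7 K, c8 K, c9 K]

end Elements

/-- Indices of the monomials `f₁^q₁ f₂^q₂ f₃^q₃ f₄^q₄ f₆^q₆` and `f₁^q₁ f₃^q₃ f₄^q₄ f₅^(q₅+1) f₆^q₆`. -/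
inductive PolyIdx : Type
  | a (q1 q2 q3 q4 q6 : ℕ)
  | b (q1 q3 q4 q5 q6 : ℕ)

/-- The monomial in `f₁, …, f₆` with a given index. -/
def polyElt (K : Type*) [Field K] : PolyIdx → MvPolynomial (Fin 6) K
  | .a q1 q2 q3 q4 q6 => f1 K ^ q1 * f2 K ^ q2 * f3 K ^ q3 * f4 K ^ q4 * f6 K ^ q6
  | .b q1 q3 q4 q5 q6 => f1 K ^ q1 * f3 K ^ q3 * f4 K ^ q4 * f5 K ^ (q5 + 1) * f6 K ^ q6

/-- Indices of the spanning set of `(L₆' / L₆'')^δ`; `e` is an exponent `0` or `1`, and `j`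
runs over the five generators `c₅, …, c₉`. -/
inductive CommIdx : Type
  | c1a (q1 q2 q3 : ℕ)
  | c1b (q2 : ℕ)
  | c2a (q1 q2 q3 : ℕ) (e : Fin 2)
  | c2b (q2 q3 : ℕ)
  | c3a (q2 q3 : ℕ)
  | c4a (q1 q2 q3 q4 : ℕ) (e : Fin 2)
  | c4b (q1 q3 q4 q5 : ℕ) (e : Fin 2)
  | cja (j : Fin 5) (q1 q2 q3 q4 q6 : ℕ)
  | cjb (j : Fin 5) (q1 q3 q4 q5 q6 : ℕ)
  | c10a

/-- The element of the spanning set with a given index. -/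
def commElt (K : Type*) [Field K] : CommIdx → Comm K 6
  | .c1a q1 q2 q3 => (f1 K ^ q1 * f2 K ^ q2 * f3 K ^ q3) • c1 K
  | .c1b q2 => (f2 K ^ q2 * f6 K) • c1 K
  | .c2a q1 q2 q3 e => (f1 K ^ q1 * f2 K ^ q2 * f3 K ^ q3 * f4 K ^ (e : ℕ)) • c2 K
  | .c2b q2 q3 => (f2 K ^ q2 * f3 K ^ q3 * f6 K) • c2 K
  | .c3a q2 q3 => (f2 K ^ q2 * f3 K ^ q3) • c3 K
  | .c4a q1 q2 q3 q4 e =>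
      (f1 K ^ q1 * f2 K ^ q2 * f3 K ^ q3 * f4 K ^ q4 * f6 K ^ (e : ℕ)) • c4 K
  | .c4b q1 q3 q4 q5 e =>
      (f1 K ^ q1 * f3 K ^ q3 * f4 K ^ q4 * f5 K ^ (q5 + 1) * f6 K ^ (e : ℕ)) • c4 K
  | .cja j q1 q2 q3 q4 q6 =>
      (f1 K ^ q1 * f2 K ^ q2 * f3 K ^ q3 * f4 K ^ q4 * f6 K ^ q6) • c5to9 K j
  | .cjb j q1 q3 q4 q5 q6 =>
      (f1 K ^ q1 * f3 K ^ q3 * f4 K ^ q4 * f5 K ^ (q5 + 1) * f6 K ^ q6) • c5to9 K j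
  | .c10a => c10 K

end FreeMetab

end

open FreeMetab

/-!
The derivation `δ` is inverted after multiplication by powers of `x₁`, and the two bases are recovered
from the quotients by `x₁`.

Both bases come from one principle. Let `T` be an injective operator (here multiplication by `x₁ = f₁`),
`b` a family that is stable under `T`, and `ψ` a linear map that kills the range of `T`. If the members
of `b` that are not of the form `T (b i)` have linearly independent images under `ψ`, then `b` is
linearly independent (`linearIndependent_of_linearIndepOn_mod`) and its span contains `u` as soon as it
contains `T u` (`mem_span_of_map_mem_span`).

*The polynomial algebra.* For `ψ` one takes the specialization `x₁ = x₄ = 0`, which sends the normal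
monomials without `f₁` to distinct monomials. Since `x₁x₄ = f₄ + x₂f₂` and `x₁x₆ = f₅ + x₂f₃`, a power of
`x₁` carries any polynomial into `K[f₁, …, f₆][x₂]`, where `δ` is `x₁ · d/dx₂`. Hence a constant lies in
`K[f₁, …, f₆]` after multiplication by a power of `x₁`, and saturation removes that power. As the
relation suffices to reduce all monomials to the independent normal ones, it generates all relations
(`ker_aeval_fgen`).

*The commutator ideal.* It embeds into the free module `K[X₆]⁶` by `[x_i, x_j] ↦ x_j e_i - x_i e_j`
(`commEmb`); injectivity follows from the Jacobi identity by an explicit homotopy in characteristic `0`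
(`sum_homotopy_commEmb`). Relations between `c₁, …, c₁₀` are thus polynomial identities. The family
`commElt` is not stable under `f₁`, so it is replaced by the family `newElt` of all
`c₁f₁^q₁f₂^q₂`, all multiples of `c₂`, `c₃`, `c₁₀` by monomials in `f₁, f₂, f₃`, and the same multiples of
`c₄, …, c₉` as in `commElt`. Modulo `x₁` its members without `f₁` are independent: after the
specialization, the coordinates of a relation are compared by degrees in two variables
(`eq_zero_of_specialized_relation`). Its span is a module over the algebra of constants by the relations
(`smul_mem_span_newElt`). For a constant `u` one has `x₁u = ∑ p_i [x_i, x₁]` by the Jacobi identity, and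
`δ(x₁u) = 0` forces `x₁²u` to be a combination of `c₁, c₂, c₄, c₇, c₈` with constant coefficients, so
saturation gives that `newElt` is a basis. A triangular change of basis leads back to `commElt`.
-/

noncomputable section

namespace FreeMetab

/-! ### Bases that are adapted to an injective operator -/

section Linear

variable {K V W ι : Type*} [Field K] [AddCommGroup V] [Module K V] [AddCommGroup W] [Module K W]

/-- Let `ψ` vanish on the range of `T`, let `b (s i) = T (b i)`, and let the remaining members of `b`
have linearly independent images under `ψ`. Then a linear combination of `b` that `ψ` kills involves
only the members `b (s i)`. -/
theorem exists_linearCombination_eq_map (T : V →ₗ[K] V) (ψ : V →ₗ[K] W)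
    (hψ : ∀ v, ψ (T v) = 0) (b : ι → V) (s : ι → ι) (hs : Function.Injective s)
    (hb : ∀ i, b (s i) = T (b i)) (hli : LinearIndepOn K (ψ ∘ b) (Set.range s)ᶜ)
    (l : ι →₀ K) (hl : ψ (Finsupp.linearCombination K b l) = 0) :
    ∃ l' : ι →₀ K, l = l'.mapDomain s ∧
      Finsupp.linearCombination K b l = T (Finsupp.linearCombination K b l') := by
  classical
  have key : ∀ l' : ι →₀ K, Finsupp.linearCombination K b (l'.mapDomain s)
      = T (Finsupp.linearCombination K b l') := by
    intro l'
    rw [Finsupp.linearCombination_mapDomain, Finsupp.apply_linearCombination]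
    have h : b ∘ s = T ∘ b := _root_.funext hb
    rw [h]
  have h2 : (Finsupp.comapDomain s l hs.injOn).mapDomain s = l.filter (· ∈ Set.range s) := by
    ext i
    by_cases hi : i ∈ Set.range s
    · obtain ⟨j, rfl⟩ := hi
      rw [Finsupp.mapDomain_apply hs, Finsupp.filter_apply_pos _ _ ⟨j, rfl⟩]; rfl
    · rw [Finsupp.mapDomain_of_notMem_range _ _ hi, Finsupp.filter_apply_neg _ _ hi]
  have h3 : l.filter (fun i => ¬ i ∈ Set.range s) = 0 := by
    refine linearIndepOn_iff.1 hli _ ?_ ?_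
    · rw [Finsupp.mem_supported]
      intro i hi
      rw [Finset.mem_coe, Finsupp.support_filter, Finset.mem_filter] at hi
      exact hi.2
    · rw [← Finsupp.apply_linearCombination, ← hl]
      conv_rhs => rw [← Finsupp.filter_add_filter_not l (· ∈ Set.range s)]
      rw [map_add, map_add, ← h2, key, hψ, zero_add]
  refine ⟨Finsupp.comapDomain s l hs.injOn, ?_, ?_⟩
  · rw [h2]
    conv_lhs => rw [← Finsupp.filter_add_filter_not l (· ∈ Set.range s), h3, add_zero]
  · rw [← key, h2]
    conv_lhs => rw [← Finsupp.filter_add_filter_not l (· ∈ Set.range s), h3, add_zero]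

/-- Independence descends from the quotient by an injective operator `T`: the weight `q`, which `s`
increases, makes repeated division by `T` stop. -/
theorem linearIndependent_of_linearIndepOn_mod (T : V →ₗ[K] V) (hT : Function.Injective T)
    (ψ : V →ₗ[K] W) (hψ : ∀ v, ψ (T v) = 0) (b : ι → V) (s : ι → ι) (hs : Function.Injective s)
    (hb : ∀ i, b (s i) = T (b i)) (q : ι → ℕ) (hq : ∀ i, q i < q (s i))
    (hli : LinearIndepOn K (ψ ∘ b) (Set.range s)ᶜ) : LinearIndependent K b := by
  have main : ∀ (n : ℕ) (l : ι →₀ K), (∀ i ∈ l.support, q i < n) →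
      Finsupp.linearCombination K b l = 0 → l = 0 := by
    classical
    intro n
    induction n with
    | zero =>
      intro l hl _
      ext i
      by_contra hi
      exact absurd (hl i (Finsupp.mem_support_iff.2 hi)) (Nat.not_lt_zero _)
    | succ n ih =>
      intro l hl h0
      obtain ⟨l', rfl, h2⟩ := exists_linearCombination_eq_map T ψ hψ b s hs hb hli l (by rw [h0, map_zero])
      rw [h0] at h2
      have h3 : l' = 0 := by
        refine ih l' (fun i hi => ?_) (hT (by rw [← h2, map_zero]))
        have := hl (s i) (by
          rw [Finsupp.mem_support_iff, Finsupp.mapDomain_apply hs]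
          exact Finsupp.mem_support_iff.1 hi)
        have := hq i
        omega
      rw [h3, Finsupp.mapDomain_zero]
  rw [linearIndependent_iff]
  intro l hl
  refine main (l.support.sup q + 1) l (fun i hi => ?_) hl
  exact Nat.lt_succ_of_le (Finset.le_sup hi)

/-- The span of `b` is saturated with respect to `T`. -/
theorem mem_span_of_map_mem_span (T : V →ₗ[K] V) (hT : Function.Injective T)
    (ψ : V →ₗ[K] W) (hψ : ∀ v, ψ (T v) = 0) (b : ι → V) (s : ι → ι) (hs : Function.Injective s)
    (hb : ∀ i, b (s i) = T (b i))
    (hli : LinearIndepOn K (ψ ∘ b) (Set.range s)ᶜ) {u : V}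
    (hu : T u ∈ Submodule.span K (Set.range b)) : u ∈ Submodule.span K (Set.range b) := by
  rw [Finsupp.mem_span_range_iff_exists_finsupp] at hu
  obtain ⟨l, hl⟩ := hu
  obtain ⟨l', -, h2⟩ := exists_linearCombination_eq_map T ψ hψ b s hs hb hli l (by
    rw [Finsupp.linearCombination_apply, hl, hψ])
  rw [Finsupp.linearCombination_apply, hl] at h2
  rw [hT h2]
  exact Finsupp.mem_span_range_iff_exists_finsupp.2 ⟨l', rfl⟩

end Linear

/-! ### Normal forms of monomials in six elements with the Plücker relation -/

section PolyMon

variable {K R : Type*} [Field K] [CommRing R] [Algebra K R]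

/-- The monomials of `polyElt` in an arbitrary family `g`. -/
def polyMon (g : Fin 6 → R) : PolyIdx → R
  | .a q1 q2 q3 q4 q6 => g 0 ^ q1 * g 1 ^ q2 * g 2 ^ q3 * g 3 ^ q4 * g 5 ^ q6
  | .b q1 q3 q4 q5 q6 => g 0 ^ q1 * g 2 ^ q3 * g 3 ^ q4 * g 4 ^ (q5 + 1) * g 5 ^ q6

variable (K) in
theorem polyMon_mul_mem (g : Fin 6 → R) (hg : g 0 * g 5 - g 1 * g 4 + g 2 * g 3 = 0) (i : Fin 6)
    (m : PolyIdx) : g i * polyMon g m ∈ Submodule.span K (Set.range (polyMon g)) := by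
  have hs : ∀ m, polyMon g m ∈ Submodule.span K (Set.range (polyMon g)) :=
    fun m => Submodule.subset_span ⟨m, rfl⟩
  have h14 : g 1 * g 4 = g 0 * g 5 + g 2 * g 3 := by linear_combination -hg
  rcases m with ⟨q1, q2, q3, q4, q6⟩ | ⟨q1, q3, q4, q5, q6⟩
  · fin_cases i
    · convert hs (.a (q1 + 1) q2 q3 q4 q6) using 1; simp [polyMon]; ring
    · convert hs (.a q1 (q2 + 1) q3 q4 q6) using 1; simp [polyMon]; ring
    · convert hs (.a q1 q2 (q3 + 1) q4 q6) using 1; simp [polyMon]; ring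
    · convert hs (.a q1 q2 q3 (q4 + 1) q6) using 1; simp [polyMon]; ring
    · rcases q2 with _ | q2
      · convert hs (.b q1 q3 q4 0 q6) using 1; simp [polyMon]; ring
      · convert add_mem (hs (.a (q1 + 1) q2 q3 q4 (q6 + 1))) (hs (.a q1 q2 (q3 + 1) (q4 + 1) q6))
          using 1
        simp only [polyMon, Fin.reduceFinMk]
        linear_combination (g 0 ^ q1 * g 1 ^ q2 * g 2 ^ q3 * g 3 ^ q4 * g 5 ^ q6) * h14
    · convert hs (.a q1 q2 q3 q4 (q6 + 1)) using 1; simp [polyMon]; ring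
  · fin_cases i
    · convert hs (.b (q1 + 1) q3 q4 q5 q6) using 1; simp [polyMon]; ring
    · rcases q5 with _ | q5
      · convert add_mem (hs (.a (q1 + 1) 0 q3 q4 (q6 + 1))) (hs (.a q1 0 (q3 + 1) (q4 + 1) q6))
          using 1
        simp only [polyMon, Fin.mk_one]
        linear_combination (g 0 ^ q1 * g 2 ^ q3 * g 3 ^ q4 * g 5 ^ q6) * h14
      · convert add_mem (hs (.b (q1 + 1) q3 q4 q5 (q6 + 1))) (hs (.b q1 (q3 + 1) (q4 + 1) q5 q6))
          using 1
        simp only [polyMon, Fin.mk_one]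
        linear_combination (g 0 ^ q1 * g 2 ^ q3 * g 3 ^ q4 * g 4 ^ (q5 + 1) * g 5 ^ q6) * h14
    · convert hs (.b q1 (q3 + 1) q4 q5 q6) using 1; simp [polyMon]; ring
    · convert hs (.b q1 q3 (q4 + 1) q5 q6) using 1; simp [polyMon]; ring
    · convert hs (.b q1 q3 q4 (q5 + 1) q6) using 1; simp [polyMon]; ring
    · convert hs (.b q1 q3 q4 q5 (q6 + 1)) using 1; simp [polyMon]; ring

variable (K) in
/-- The relation `g₁g₆ - g₂g₅ + g₃g₄ = 0` (numbered from `1`) rewrites every product `g₂g₅`, so the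
monomials without `g₂g₅` span the generated algebra. -/
theorem span_polyMon (g : Fin 6 → R) (hg : g 0 * g 5 - g 1 * g 4 + g 2 * g 3 = 0) :
    Submodule.span K (Set.range (polyMon g))
      = Subalgebra.toSubmodule (Algebra.adjoin K (Set.range g)) := by
  have hmul : ∀ i, ∀ p ∈ Submodule.span K (Set.range (polyMon g)),
      g i * p ∈ Submodule.span K (Set.range (polyMon g)) := by
    intro i p hp
    induction hp using Submodule.span_induction with
    | mem x hx => obtain ⟨m, rfl⟩ := hx; exact polyMon_mul_mem K g hg i m
    | zero => simp
    | add x y _ _ hx hy => rw [mul_add]; exact add_mem hx hy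
    | smul t x _ hx => rw [mul_smul_comm]; exact Submodule.smul_mem _ t hx
  apply le_antisymm
  · rw [Submodule.span_le, Subalgebra.coe_toSubmodule]
    have hg' : ∀ i, g i ∈ Algebra.adjoin K (Set.range g) :=
      fun i => Algebra.subset_adjoin ⟨i, rfl⟩
    rintro _ ⟨⟨q1, q2, q3, q4, q6⟩ | ⟨q1, q3, q4, q5, q6⟩, rfl⟩
    · exact mul_mem (mul_mem (mul_mem (mul_mem (pow_mem (hg' _) _) (pow_mem (hg' _) _))
        (pow_mem (hg' _) _)) (pow_mem (hg' _) _)) (pow_mem (hg' _) _)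
    · exact mul_mem (mul_mem (mul_mem (mul_mem (pow_mem (hg' _) _) (pow_mem (hg' _) _))
        (pow_mem (hg' _) _)) (pow_mem (hg' _) _)) (pow_mem (hg' _) _)
  · intro p hp
    suffices h : ∀ w ∈ Submodule.span K (Set.range (polyMon g)),
        p * w ∈ Submodule.span K (Set.range (polyMon g)) by
      have h1 := h 1 (Submodule.subset_span ⟨.a 0 0 0 0 0, by simp [polyMon]⟩)
      rwa [mul_one] at h1
    rw [Subalgebra.mem_toSubmodule] at hp
    induction hp using Algebra.adjoin_induction with
    | mem x hx => obtain ⟨i, rfl⟩ := hx; exact hmul i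
    | algebraMap t =>
      intro w hw
      rw [← Algebra.smul_def]; exact Submodule.smul_mem _ t hw
    | add x y _ _ hx hy => intro w hw; rw [add_mul]; exact add_mem (hx w hw) (hy w hw)
    | mul x y _ _ hx hy => intro w hw; rw [mul_assoc]; exact hx _ (hy w hw)

end PolyMon

/-! ### Specialization at `x₁ = x₄ = 0` and independence of the monomials in the `f_i` -/

section Specialize

variable (K : Type*) [Field K]

/-- The specialization `x₁ = x₄ = 0`, `x₂ = -t`, `x₃ = a`, `x₅ = b`, `x₆ = z` with values in
`K[a, b, t, z]`, whose variables are numbered in this order. The sign of `t` makes the images of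
`f₂, …, f₆` monomials with coefficient `1`. -/
def specialize : MvPolynomial (Fin 6) K →ₐ[K] MvPolynomial (Fin 4) K :=
  aeval ![0, -X 2, X 0, 0, X 1, X 3]

/-- The monomial `a ^ e₁ b ^ e₂ t ^ e₃ z ^ e₄`. -/
def specMonomial (e : ℕ × ℕ × ℕ × ℕ) : MvPolynomial (Fin 4) K :=
  X 0 ^ e.1 * X 1 ^ e.2.1 * X 2 ^ e.2.2.1 * X 3 ^ e.2.2.2

theorem specMonomial_eq (e : ℕ × ℕ × ℕ × ℕ) : specMonomial K e = basisMonomials (Fin 4) K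
    (Finsupp.equivFunOnFinite.symm ![e.1, e.2.1, e.2.2.1, e.2.2.2]) := by
  rw [coe_basisMonomials]
  beta_reduce
  rw [monomial_eq, Finsupp.prod_fintype _ _ (by simp)]
  simp [Fin.prod_univ_four, specMonomial]

theorem linearIndependent_specMonomial : LinearIndependent K (specMonomial K) := by
  rw [_root_.funext (specMonomial_eq K)]
  refine (basisMonomials (Fin 4) K).linearIndependent.comp _ (fun e e' h => ?_)
  have h' := Finsupp.equivFunOnFinite.symm.injective h
  simp only [Matrix.vecCons_inj] at h'
  exact Prod.ext h'.1 (Prod.ext h'.2.1 (Prod.ext h'.2.2.1 h'.2.2.2.1))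

/-- The exponents of the image of `polyElt K m` under `specialize`, for `m` with `q₁ = 0`. -/
def specExp : PolyIdx → ℕ × ℕ × ℕ × ℕ
  | .a _ q2 q3 q4 q6 => (q2 + q4 + q6, q3, q4, q6)
  | .b _ q3 q4 q5 q6 => (q4 + q6, q3 + q5 + 1, q4 + q5 + 1, q6)

/-- Multiplication by `f₁` on indices. -/
def idxSucc : PolyIdx → PolyIdx
  | .a q1 q2 q3 q4 q6 => .a (q1 + 1) q2 q3 q4 q6
  | .b q1 q3 q4 q5 q6 => .b (q1 + 1) q3 q4 q5 q6

/-- The exponent of `f₁`. -/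
def idxOne : PolyIdx → ℕ
  | .a q1 _ _ _ _ => q1
  | .b q1 _ _ _ _ => q1

theorem idxSucc_injective : Function.Injective idxSucc := by
  rintro (⟨⟩ | ⟨⟩) (⟨⟩ | ⟨⟩) h <;> simp_all [idxSucc]

theorem idxOne_idxSucc (m : PolyIdx) : idxOne (idxSucc m) = idxOne m + 1 := by
  cases m <;> rfl

theorem mem_range_idxSucc {m : PolyIdx} : m ∈ Set.range idxSucc ↔ idxOne m ≠ 0 := by
  constructor
  · rintro ⟨m, rfl⟩; rw [idxOne_idxSucc]; exact Nat.succ_ne_zero _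
  · rcases m with ⟨_ | q1, q2, q3, q4, q6⟩ | ⟨_ | q1, q3, q4, q5, q6⟩ <;> intro h
    · exact absurd rfl h
    · exact ⟨.a q1 q2 q3 q4 q6, rfl⟩
    · exact absurd rfl h
    · exact ⟨.b q1 q3 q4 q5 q6, rfl⟩

theorem polyElt_idxSucc (m : PolyIdx) : polyElt K (idxSucc m) = X 0 * polyElt K m := by
  cases m <;> simp only [idxSucc, polyElt, f1] <;> ring

theorem specExp_injOn : Set.InjOn specExp {m | idxOne m = 0} := by
  rintro (⟨⟩ | ⟨⟩) h (⟨⟩ | ⟨⟩) h' h2 <;>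
  simp only [specExp, Prod.mk.injEq, idxOne, Set.mem_ofPred_eq] at h h' h2 <;> grind

@[simp] theorem specialize_f1 : specialize K (f1 K) = 0 := by simp [specialize, f1]
@[simp] theorem specialize_f2 : specialize K (f2 K) = X 0 := by simp [specialize, f2]
@[simp] theorem specialize_f3 : specialize K (f3 K) = X 1 := by simp [specialize, f3]
@[simp] theorem specialize_f4 : specialize K (f4 K) = X 2 * X 0 := by simp [specialize, f4]
@[simp] theorem specialize_f5 : specialize K (f5 K) = X 2 * X 1 := by simp [specialize, f5]
@[simp] theorem specialize_f6 : specialize K (f6 K) = X 0 * X 3 := by simp [specialize, f6]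

theorem specialize_polyElt {m : PolyIdx} (hm : idxOne m = 0) :
    specialize K (polyElt K m) = specMonomial K (specExp m) := by
  cases m <;> simp only [idxOne] at hm <;> subst hm <;>
    simp only [polyElt, specExp, specMonomial, map_mul, map_pow, specialize_f1, specialize_f2,
      specialize_f3, specialize_f4, specialize_f5, specialize_f6] <;> ring

theorem linearIndepOn_specialize_polyElt :
    LinearIndepOn K ((specialize K).toLinearMap ∘ polyElt K) (Set.range idxSucc)ᶜ := by
  have hm : ∀ m : ((Set.range idxSucc)ᶜ : Set PolyIdx), idxOne m.1 = 0 := fun m => by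
    by_contra h
    exact m.2 (mem_range_idxSucc.2 h)
  have h := (linearIndependent_specMonomial K).comp
    (fun m : ((Set.range idxSucc)ᶜ : Set PolyIdx) => specExp m)
    (fun m m' h => Subtype.ext (specExp_injOn (hm m) (hm m') h))
  rw [LinearIndepOn]
  convert h using 1
  funext m
  exact specialize_polyElt K (hm m)

theorem mulLeft_X_injective :
    Function.Injective (LinearMap.mulLeft K (X 0 : MvPolynomial (Fin 6) K)) :=
  fun _ _ h => mul_left_cancel₀ (X_ne_zero 0) h

theorem linearIndependent_polyElt : LinearIndependent K (polyElt K) :=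
  linearIndependent_of_linearIndepOn_mod (LinearMap.mulLeft K (X 0)) (mulLeft_X_injective K)
    (specialize K).toLinearMap (fun v => by simp [specialize]) (polyElt K) idxSucc
    idxSucc_injective (polyElt_idxSucc K) idxOne (fun m => by rw [idxOne_idxSucc]; omega)
    (linearIndepOn_specialize_polyElt K)

/-- The span of the monomials in the `f_i` is saturated with respect to `x₁`. -/
theorem mem_span_polyElt_of_X_mul_mem {p : MvPolynomial (Fin 6) K}
    (hp : X 0 * p ∈ Submodule.span K (Set.range (polyElt K))) :
    p ∈ Submodule.span K (Set.range (polyElt K)) :=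
  mem_span_of_map_mem_span (LinearMap.mulLeft K (X 0)) (mulLeft_X_injective K)
    (specialize K).toLinearMap (fun v => by simp [specialize]) (polyElt K) idxSucc
    idxSucc_injective (polyElt_idxSucc K) (linearIndepOn_specialize_polyElt K) hp

end Specialize

/-! ### The constants of the polynomial algebra -/

section Constants

variable (K : Type*) [Field K]

/-- The family `f₁, …, f₆`. -/
def fgen : Fin 6 → MvPolynomial (Fin 6) K := ![f1 K, f2 K, f3 K, f4 K, f5 K, f6 K]

theorem fgen_relation :
    fgen K 0 * fgen K 5 - fgen K 1 * fgen K 4 + fgen K 2 * fgen K 3 = 0 := by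
  change f1 K * f6 K - f2 K * f5 K + f3 K * f4 K = 0
  simp only [f1, f2, f3, f4, f5, f6]; ring

theorem polyMon_fgen : polyMon (fgen K) = polyElt K := by
  funext m; cases m <;> rfl

theorem range_fgen : Set.range (fgen K) = {f1 K, f2 K, f3 K, f4 K, f5 K, f6 K} := by
  simp only [fgen, Matrix.range_cons, Matrix.range_empty, Set.union_empty, Set.singleton_union]

theorem span_polyElt : Submodule.span K (Set.range (polyElt K))
    = Subalgebra.toSubmodule (Algebra.adjoin K (Set.range (fgen K))) := by
  rw [← polyMon_fgen, span_polyMon K _ (fgen_relation K)]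

theorem polyDelta_X (i : Fin 6) : polyDelta (J222 K) (X i) = ![0, X 0, 0, X 2, 0, X 4] i := by
  rw [polyDelta, mkDerivation_X]
  fin_cases i <;> simp [J222, Fin.sum_univ_six]

theorem polyDelta_fgen (i : Fin 6) : polyDelta (J222 K) (fgen K i) = 0 := by
  fin_cases i <;> simp [fgen, f1, f2, f3, f4, f5, f6, polyDelta_X] <;> ring

theorem adjoin_fgen_le : Algebra.adjoin K (Set.range (fgen K)) ≤ polyConst (J222 K) := by
  rw [Algebra.adjoin_le_iff]
  rintro _ ⟨i, rfl⟩
  exact polyDelta_fgen K i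

/-- After inverting `x₁`, the polynomial ring is generated by `x₂` over the constants `f₁, …, f₆`,
because `x₁x₄ = f₄ + x₂f₂` and `x₁x₆ = f₅ + x₂f₃`. -/
theorem exists_X_pow_mul_eq_aeval (p : MvPolynomial (Fin 6) K) :
    ∃ (N : ℕ) (G : Polynomial (Algebra.adjoin K (Set.range (fgen K)))),
      X 0 ^ N * p = Polynomial.aeval (X 1 : MvPolynomial (Fin 6) K) G := by
  have hf : ∀ i, fgen K i ∈ Algebra.adjoin K (Set.range (fgen K)) :=
    fun i => Algebra.subset_adjoin ⟨i, rfl⟩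
  let g : Fin 6 → Algebra.adjoin K (Set.range (fgen K)) := fun i => ⟨fgen K i, hf i⟩
  have hg : ∀ i, algebraMap _ (MvPolynomial (Fin 6) K) (g i) = fgen K i := fun i => rfl
  have hX : ∀ i : Fin 6, ∃ (N : ℕ) (G : Polynomial (Algebra.adjoin K (Set.range (fgen K)))),
      X 0 ^ N * X i = Polynomial.aeval (X 1 : MvPolynomial (Fin 6) K) G := by
    intro i
    fin_cases i
    · exact ⟨0, Polynomial.C (g 0), by rw [Polynomial.aeval_C, hg]; simp [fgen, f1]⟩
    · exact ⟨0, Polynomial.X, by simp⟩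
    · exact ⟨0, Polynomial.C (g 1), by rw [Polynomial.aeval_C, hg]; simp [fgen, f2]⟩
    · exact ⟨1, Polynomial.C (g 3) + Polynomial.X * Polynomial.C (g 1), by
        simp only [map_add, map_mul, Polynomial.aeval_C, hg, Polynomial.aeval_X]
        simp [fgen, f2, f4]⟩
    · exact ⟨0, Polynomial.C (g 2), by rw [Polynomial.aeval_C, hg]; simp [fgen, f3]⟩
    · exact ⟨1, Polynomial.C (g 4) + Polynomial.X * Polynomial.C (g 2), by
        simp only [map_add, map_mul, Polynomial.aeval_C, hg, Polynomial.aeval_X]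
        simp [fgen, f3, f5]⟩
  have hpow : ∀ N : ℕ, Polynomial.aeval (X 1 : MvPolynomial (Fin 6) K) (Polynomial.C (g 0) ^ N)
      = X 0 ^ N := by
    intro N
    rw [map_pow, Polynomial.aeval_C, hg]; rfl
  induction p using MvPolynomial.induction_on with
  | C t => exact ⟨0, Polynomial.C (algebraMap K _ t), by
      rw [Polynomial.aeval_C, pow_zero, one_mul]; rfl⟩
  | add p q hp hq =>
    obtain ⟨N, G, h⟩ := hp
    obtain ⟨N', G', h'⟩ := hq
    refine ⟨N + N', Polynomial.C (g 0) ^ N' * G + Polynomial.C (g 0) ^ N * G', ?_⟩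
    rw [map_add, map_mul, map_mul, hpow, hpow, ← h, ← h']
    ring
  | mul_X p i hp =>
    obtain ⟨N, G, h⟩ := hp
    obtain ⟨N', G', h'⟩ := hX i
    refine ⟨N + N', G * G', ?_⟩
    rw [map_mul, ← h, ← h']
    ring

/-- On polynomials in `x₂` over constants, `δ` is `x₁ · d/dx₂`. -/
theorem polyDelta_aeval (G : Polynomial (Algebra.adjoin K (Set.range (fgen K)))) :
    polyDelta (J222 K) (Polynomial.aeval (X 1 : MvPolynomial (Fin 6) K) G)
      = X 0 * Polynomial.aeval (X 1 : MvPolynomial (Fin 6) K) (Polynomial.derivative G) := by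
  induction G using Polynomial.induction_on' with
  | add p q hp hq => simp only [map_add, hp, hq, mul_add]
  | monomial n c =>
    have hc : polyDelta (J222 K) (c : MvPolynomial (Fin 6) K) = 0 := adjoin_fgen_le K c.2
    rw [Polynomial.derivative_monomial, Polynomial.aeval_monomial, Polynomial.aeval_monomial,
      Derivation.leibniz, Derivation.leibniz_pow, polyDelta_X]
    change _ + _ • polyDelta (J222 K) (c : MvPolynomial (Fin 6) K) = _
    rw [hc, map_mul, map_natCast]
    simp
    ring

/-- `x₂` is transcendental over the algebra generated by the constants `f_i`; this uses characteristic
`0`. -/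
theorem aeval_X_injective [CharZero K] (G : Polynomial (Algebra.adjoin K (Set.range (fgen K))))
    (hG : Polynomial.aeval (X 1 : MvPolynomial (Fin 6) K) G = 0) : G = 0 := by
  have : CharZero (Algebra.adjoin K (Set.range (fgen K))) :=
    charZero_of_injective_algebraMap (algebraMap K _).injective
  induction hn : G.natDegree using Nat.strong_induction_on generalizing G with
  | _ n ih =>
    subst hn
    have h1 : Polynomial.aeval (X 1 : MvPolynomial (Fin 6) K) (Polynomial.derivative G) = 0 := by
      have h := polyDelta_aeval K G
      rw [hG, map_zero] at h
      exact (mul_eq_zero.1 h.symm).resolve_left (X_ne_zero 0)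
    have h0 : G.natDegree = 0 := by
      by_contra hne
      exact hne (Polynomial.derivative_eq_zero.1
        (ih _ (Polynomial.natDegree_derivative_lt hne) _ h1 rfl))
    rw [Polynomial.eq_C_of_natDegree_eq_zero h0, Polynomial.aeval_C] at hG
    rw [Polynomial.eq_C_of_natDegree_eq_zero h0]
    rw [show G.coeff 0 = 0 from Subtype.ext hG, Polynomial.C_0]

/-- After multiplication by a power of `x₁`, a constant is a polynomial in `x₂` over `K[f₁, …, f₆]`
with vanishing derivative, hence an element of `K[f₁, …, f₆]`; saturation removes the power of `x₁`. -/
theorem mem_span_polyElt_of_polyDelta_eq_zero [CharZero K] {p : MvPolynomial (Fin 6) K}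
    (hp : polyDelta (J222 K) p = 0) : p ∈ Submodule.span K (Set.range (polyElt K)) := by
  have : CharZero (Algebra.adjoin K (Set.range (fgen K))) :=
    charZero_of_injective_algebraMap (algebraMap K _).injective
  obtain ⟨N, G, h⟩ := exists_X_pow_mul_eq_aeval K p
  have hder : Polynomial.derivative G = 0 := by
    apply aeval_X_injective
    have h1 := polyDelta_aeval K G
    rw [← h, Derivation.leibniz, hp, Derivation.leibniz_pow, polyDelta_X] at h1
    simp only [Matrix.cons_val_zero, smul_zero, zero_add] at h1
    exact (mul_eq_zero.1 h1.symm).resolve_left (X_ne_zero 0)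
  have hN : X 0 ^ N * p ∈ Submodule.span K (Set.range (polyElt K)) := by
    rw [span_polyElt, h, Polynomial.eq_C_of_natDegree_eq_zero
      (Polynomial.derivative_eq_zero.1 hder), Polynomial.aeval_C]
    exact (G.coeff 0).2
  clear h
  induction N with
  | zero => simpa using hN
  | succ N ih => exact ih (mem_span_polyElt_of_X_mul_mem K (by rwa [← mul_assoc, ← pow_succ']))

theorem span_polyElt_eq_polyConst [CharZero K] : Submodule.span K (Set.range (polyElt K))
    = Subalgebra.toSubmodule (polyConst (J222 K)) := by
  apply le_antisymm
  · rw [span_polyElt]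
    exact adjoin_fgen_le K
  · exact fun p hp => mem_span_polyElt_of_polyDelta_eq_zero K hp

theorem polyConst_eq_adjoin [CharZero K] :
    polyConst (J222 K) = Algebra.adjoin K (Set.range (fgen K)) := by
  apply Subalgebra.toSubmodule_injective
  rw [← span_polyElt_eq_polyConst, span_polyElt]

/-- Modulo the relation every polynomial is a combination of normal monomials, and these have linearly
independent images. -/
theorem ker_aeval_fgen : RingHom.ker (aeval (R := K) (fgen K)) =
    Ideal.span {(X 0 * X 5 - X 1 * X 4 + X 2 * X 3 : MvPolynomial (Fin 6) K)} := by
  set r : MvPolynomial (Fin 6) K := X 0 * X 5 - X 1 * X 4 + X 2 * X 3 with hr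
  set I := Ideal.span {r} with hI
  have hle : I ≤ RingHom.ker (aeval (R := K) (fgen K)) := by
    rw [hI, Ideal.span_singleton_le_iff_mem, RingHom.mem_ker, hr]
    simpa using fgen_relation K
  apply le_antisymm _ hle
  intro F hF
  let g : Fin 6 → MvPolynomial (Fin 6) K ⧸ I := fun i => Ideal.Quotient.mkₐ K I (X i)
  have hg : g 0 * g 5 - g 1 * g 4 + g 2 * g 3 = 0 := by
    simp only [g, ← map_mul, ← map_sub, ← map_add]
    exact Ideal.Quotient.eq_zero_iff_mem.2 (Ideal.mem_span_singleton_self r)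
  let φ : MvPolynomial (Fin 6) K ⧸ I →ₐ[K] MvPolynomial (Fin 6) K :=
    Ideal.Quotient.liftₐ I (aeval (fgen K)) (fun a ha => hle ha)
  have hφ : ∀ p, φ (Ideal.Quotient.mkₐ K I p) = aeval (fgen K) p := fun p => rfl
  have hφg : ∀ i, φ (g i) = fgen K i := fun i => by rw [hφ, aeval_X]
  have hφm : φ.toLinearMap ∘ polyMon g = polyElt K := by
    rw [← polyMon_fgen]
    funext m
    cases m <;> simp [polyMon, hφg]
  have hmem : Ideal.Quotient.mkₐ K I F ∈ Submodule.span K (Set.range (polyMon g)) := by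
    have h1 : Ideal.Quotient.mkₐ K I = aeval g := by
      ext i; simp [g]
    rw [span_polyMon K g hg, Subalgebra.mem_toSubmodule, Algebra.adjoin_range_eq_range_aeval, h1]
    exact ⟨F, rfl⟩
  rw [Finsupp.mem_span_range_iff_exists_finsupp] at hmem
  obtain ⟨l, hl⟩ := hmem
  have h0 : Finsupp.linearCombination K (polyElt K) l = 0 := by
    rw [← hφm, ← Finsupp.apply_linearCombination, Finsupp.linearCombination_apply, hl]
    exact hF
  have hl0 := (linearIndependent_iff.1 (linearIndependent_polyElt K)) l h0
  rw [hl0, Finsupp.sum_zero_index] at hl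
  exact Ideal.Quotient.eq_zero_iff_mem.1 hl.symm

end Constants

/-! ### The embedding of the commutator ideal into a free module -/

/-- A linear subspace that contains all brackets contains the derived ideal. -/
theorem mem_of_mem_derived {K : Type*} [Field K] {L : Type*} [LieRing L] [LieAlgebra K L]
    (S : Submodule K L) (hS : ∀ a b : L, ⁅a, b⁆ ∈ S) {u : L}
    (hu : u ∈ LieAlgebra.derivedSeries K L 1) : u ∈ S := by
  rw [LieAlgebra.derivedSeries_def, LieAlgebra.derivedSeriesOfIdeal_succ,
    LieAlgebra.derivedSeriesOfIdeal_zero, ← LieSubmodule.mem_toSubmodule,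
    LieSubmodule.lieIdeal_oper_eq_linear_span'] at hu
  refine Submodule.span_le.2 ?_ hu
  rintro _ ⟨a, -, b, -, rfl⟩
  exact hS a b

/-- The metabelian Lie algebra `K[X_d] ⊕ K[X_d]^d` with bracket `[(a, u), (b, v)] = (0, b u - a v)`;
`x_i ↦ (x_i, e_i)` is the Magnus type embedding of the free metabelian Lie algebra. -/
def Magnus (K : Type*) [Field K] (d : ℕ) : Type _ :=
  MvPolynomial (Fin d) K × (Fin d → MvPolynomial (Fin d) K)

section Magnus

variable {K : Type*} [Field K] {d : ℕ}

instance : AddCommGroup (Magnus K d) :=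
  inferInstanceAs (AddCommGroup (MvPolynomial (Fin d) K × (Fin d → MvPolynomial (Fin d) K)))

instance : Module K (Magnus K d) :=
  inferInstanceAs (Module K (MvPolynomial (Fin d) K × (Fin d → MvPolynomial (Fin d) K)))

instance : LieRing (Magnus K d) where
  bracket u v := (0, v.1 • u.2 - u.1 • v.2)
  add_lie u v w := Prod.ext (add_zero 0).symm (by
    change w.1 • (u.2 + v.2) - (u.1 + v.1) • w.2 = (w.1 • u.2 - u.1 • w.2) + (w.1 • v.2 - v.1 • w.2)
    module)
  lie_add u v w := Prod.ext (add_zero 0).symm (by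
    change (v.1 + w.1) • u.2 - u.1 • (v.2 + w.2) = (v.1 • u.2 - u.1 • v.2) + (w.1 • u.2 - u.1 • w.2)
    module)
  lie_self u := Prod.ext rfl (sub_self _)
  leibniz_lie u v w := Prod.ext (add_zero 0).symm (by
    change (0 : MvPolynomial (Fin d) K) • u.2 - u.1 • (w.1 • v.2 - v.1 • w.2)
      = (w.1 • (v.1 • u.2 - u.1 • v.2) - (0 : MvPolynomial (Fin d) K) • w.2)
        + ((0 : MvPolynomial (Fin d) K) • v.2 - v.1 • (w.1 • u.2 - u.1 • w.2))
    module)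

theorem Magnus.lie_def (u v : Magnus K d) :
    ⁅u, v⁆ = ((0, v.1 • u.2 - u.1 • v.2) :
      MvPolynomial (Fin d) K × (Fin d → MvPolynomial (Fin d) K)) := rfl

instance : LieAlgebra K (Magnus K d) where
  lie_smul t u v := Prod.ext (smul_zero t).symm (by
    change (t • v.1) • u.2 - u.1 • (t • v.2) = t • (v.1 • u.2 - u.1 • v.2)
    rw [smul_sub, smul_assoc, smul_comm u.1 t v.2])

theorem Magnus.metabelian (a b c e : Magnus K d) : ⁅⁅a, b⁆, ⁅c, e⁆⁆ = 0 := by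
  rw [Magnus.lie_def ⁅a, b⁆]
  refine Prod.ext rfl ?_
  change (0 : MvPolynomial (Fin d) K) • _ - (0 : MvPolynomial (Fin d) K) • _ = _
  rw [zero_smul, zero_smul, sub_zero]; rfl

variable (K d) in
/-- The homomorphism from the free Lie algebra with `x_i ↦ (x_i, e_i)`. -/
def magnusLift : FreeLieAlgebra K (Fin d) →ₗ⁅K⁆ Magnus K d :=
  FreeLieAlgebra.lift K fun i => ((X i, Pi.single i 1) :
    MvPolynomial (Fin d) K × (Fin d → MvPolynomial (Fin d) K))

theorem magnusLift_eq_zero {w : FreeLieAlgebra K (Fin d)}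
    (hw : w ∈ LieAlgebra.derivedSeries K (FreeLieAlgebra K (Fin d)) 2) :
    magnusLift K d w = 0 := by
  have h := LieIdeal.derivedSeries_map_le (f := magnusLift K d) 2
  rw [derivedSeries_two_eq_bot Magnus.metabelian] at h
  simpa using h (LieIdeal.mem_map hw)

variable (K d) in
/-- The induced map on the free metabelian Lie algebra. -/
def magnusMap : FM K d →ₗ[K] Magnus K d :=
  Submodule.liftQ (LieAlgebra.derivedSeries K (FreeLieAlgebra K (Fin d)) 2).toSubmodule
    (magnusLift K d).toLinearMap (fun _ hw => magnusLift_eq_zero hw)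

theorem magnusMap_gen (i : Fin d) : magnusMap K d (gen K i) = ((X i, Pi.single i 1) :
    MvPolynomial (Fin d) K × (Fin d → MvPolynomial (Fin d) K)) :=
  FreeLieAlgebra.lift_of_apply _ _

theorem magnusMap_lie (a b : FM K d) :
    magnusMap K d ⁅a, b⁆ = ⁅magnusMap K d a, magnusMap K d b⁆ := by
  obtain ⟨a, rfl⟩ := LieSubmodule.Quotient.surjective_mk' _ a
  obtain ⟨b, rfl⟩ := LieSubmodule.Quotient.surjective_mk' _ b
  exact LieHom.map_lie (magnusLift K d) a b

theorem magnusMap_fst_eq_zero (u : Comm K d) : (magnusMap K d (u : FM K d)).1 = 0 := by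
  let S : Submodule K (FM K d) := LinearMap.ker ((LinearMap.fst K (MvPolynomial (Fin d) K)
    (Fin d → MvPolynomial (Fin d) K)) ∘ₗ (magnusMap K d : FM K d →ₗ[K]
      MvPolynomial (Fin d) K × (Fin d → MvPolynomial (Fin d) K)))
  refine mem_of_mem_derived (K := K) S (fun a b => ?_) u.2
  change (magnusMap K d ⁅a, b⁆).1 = 0
  rw [magnusMap_lie]; rfl

variable (K d) in
/-- The `K[X_d]`-linear map `L_d' / L_d'' → K[X_d]^d` with `[x_i, x_j] ↦ x_j e_i - x_i e_j`. -/
def commEmb : Comm K d →ₗ[MvPolynomial (Fin d) K] (Fin d → MvPolynomial (Fin d) K) where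
  toFun u := (magnusMap K d (u : FM K d)).2
  map_add' u v := congrArg Prod.snd (map_add (magnusMap K d) (u : FM K d) (v : FM K d))
  map_smul' p u := by
    rw [RingHom.id_apply]
    induction p using MvPolynomial.induction_on generalizing u with
    | C t =>
      rw [C_smul_comm, ← algebraMap_eq, algebraMap_smul]
      exact congrArg Prod.snd (map_smul (magnusMap K d) t (u : FM K d))
    | add p q hp hq =>
      rw [add_smul, add_smul, ← hp, ← hq]
      exact congrArg Prod.snd (map_add (magnusMap K d) ((p • u : Comm K d) : FM K d) _)
    | mul_X p i hp =>
      rw [mul_smul, hp, mul_smul, coe_X_smul, magnusMap_lie, Magnus.lie_def, magnusMap_gen]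
      change p • ((X i : MvPolynomial (Fin d) K) • _ - (magnusMap K d (u : FM K d)).1 • _) = _
      rw [magnusMap_fst_eq_zero, zero_smul, sub_zero]

variable (K) in
/-- The commutator `[x_i, x_j]` of two of the `d` generators. -/
def genLie (i j : Fin d) : Comm K d := ⟨⁅gen K i, gen K j⁆, lie_mem_comm _ _⟩

theorem commEmb_genLie (i j : Fin d) :
    commEmb K d (genLie K i j) = X j • Pi.single i 1 - X i • Pi.single j 1 := by
  change (magnusMap K d ⁅gen K i, gen K j⁆).2 = _
  rw [magnusMap_lie, Magnus.lie_def, magnusMap_gen, magnusMap_gen]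

theorem genLie_self (i : Fin d) : genLie K i i = 0 := Subtype.ext (lie_self _)

/-- The Jacobi identity. -/
theorem X_smul_genLie (i j k : Fin d) :
    (X k : MvPolynomial (Fin d) K) • genLie K i j
      = (X j : MvPolynomial (Fin d) K) • genLie K i k
        - (X i : MvPolynomial (Fin d) K) • genLie K j k := by
  apply Subtype.ext
  rw [coe_X_smul]
  change _ = (((X j : MvPolynomial (Fin d) K) • genLie K i k : Comm K d) : FM K d)
    - (((X i : MvPolynomial (Fin d) K) • genLie K j k : Comm K d) : FM K d)
  rw [coe_X_smul, coe_X_smul]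
  change ⁅⁅gen K i, gen K j⁆, gen K k⁆
    = ⁅⁅gen K i, gen K k⁆, gen K j⁆ - ⁅⁅gen K j, gen K k⁆, gen K i⁆
  rw [lie_lie (gen K i) (gen K j) (gen K k), ← lie_skew (gen K i) ⁅gen K j, gen K k⁆,
    ← lie_skew (gen K j) ⁅gen K i, gen K k⁆]
  abel

/-! ### Generation by the commutators of the generators -/

/-- A linear subspace of the free metabelian Lie algebra that contains the generators and is closed
under the bracket is everything. -/
theorem eq_top_of_gen_mem (S : LieSubalgebra K (FM K d)) (hS : ∀ i, gen K i ∈ S) : S = ⊤ := by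
  let p : FreeLieAlgebra K (Fin d) →ₗ⁅K⁆ FM K d :=
    S.incl.comp (FreeLieAlgebra.lift K fun i => (⟨gen K i, hS i⟩ : S))
  let q : FreeLieAlgebra K (Fin d) →ₗ⁅K⁆ FM K d :=
    { toFun := fun w => (LieSubmodule.Quotient.mk w : FM K d)
      map_add' := fun a b => rfl
      map_smul' := fun t a => rfl
      map_lie' := fun {a b} => LieSubmodule.Quotient.mk_bracket _ a b }
  have hpq : p = q := by
    refine FreeLieAlgebra.hom_ext fun i => ?_
    change ((FreeLieAlgebra.lift K (fun i => (⟨gen K i, hS i⟩ : S)) (FreeLieAlgebra.of K i) : S)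
      : FM K d) = gen K i
    rw [FreeLieAlgebra.lift_of_apply]
  rw [eq_top_iff]
  intro a _
  obtain ⟨w, rfl⟩ := LieSubmodule.Quotient.surjective_mk' _ a
  have h : q w = p w := by rw [hpq]
  change q w ∈ S
  rw [h]
  exact Subtype.property _

/-- The commutator ideal is generated, as a module over the polynomial algebra, by the commutators of
the generators. -/
theorem span_genLie : Submodule.span (MvPolynomial (Fin d) K)
    (Set.range fun ij : Fin d × Fin d => genLie K ij.1 ij.2) = ⊤ := by
  set M := Submodule.span (MvPolynomial (Fin d) K)
    (Set.range fun ij : Fin d × Fin d => genLie K ij.1 ij.2) with hM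
  have hgen : ∀ i j, genLie K i j ∈ M := fun i j => Submodule.subset_span ⟨(i, j), rfl⟩
  let N : Submodule K (FM K d) := (M.restrictScalars K).map
    (LieAlgebra.derivedSeries K (FM K d) 1).toSubmodule.subtype
  let G : Submodule K (FM K d) := Submodule.span K (Set.range (gen K))
  have hNmem : ∀ n ∈ N, n ∈ LieAlgebra.derivedSeries K (FM K d) 1 := by
    rintro _ ⟨u, -, rfl⟩; exact u.2
  have hGG : ∀ a ∈ G, ∀ b ∈ G, ⁅a, b⁆ ∈ N := by
    intro a ha b hb
    induction ha using Submodule.span_induction with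
    | zero => rw [zero_lie]; exact zero_mem _
    | add x y _ _ hx hy => rw [add_lie]; exact add_mem hx hy
    | smul t x _ hx => rw [smul_lie]; exact Submodule.smul_mem _ t hx
    | mem x hx =>
      obtain ⟨i, rfl⟩ := hx
      induction hb using Submodule.span_induction with
      | zero => rw [lie_zero]; exact zero_mem _
      | add x y _ _ hx hy => rw [lie_add]; exact add_mem hx hy
      | smul t x _ hx => rw [lie_smul]; exact Submodule.smul_mem _ t hx
      | mem y hy =>
        obtain ⟨j, rfl⟩ := hy
        exact ⟨genLie K i j, hgen i j, rfl⟩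
  have hNG : ∀ a ∈ N, ∀ b ∈ G, ⁅a, b⁆ ∈ N := by
    rintro _ ⟨u, hu, rfl⟩ b hb
    induction hb using Submodule.span_induction with
    | zero => rw [lie_zero]; exact zero_mem _
    | add x y _ _ hx hy => rw [lie_add]; exact add_mem hx hy
    | smul t x _ hx => rw [lie_smul]; exact Submodule.smul_mem _ t hx
    | mem y hy =>
      obtain ⟨j, rfl⟩ := hy
      let w : Comm K d := u
      exact ⟨(X j : MvPolynomial (Fin d) K) • w, M.smul_mem _ hu, coe_X_smul j w⟩
  have hlie : ∀ a ∈ G ⊔ N, ∀ b ∈ G ⊔ N, ⁅a, b⁆ ∈ N := by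
    intro a ha b hb
    obtain ⟨a1, ha1, a2, ha2, rfl⟩ := Submodule.mem_sup.1 ha
    obtain ⟨b1, hb1, b2, hb2, rfl⟩ := Submodule.mem_sup.1 hb
    rw [add_lie, lie_add, lie_add,
      lie_eq_zero_of_mem (K := K) metabelian (hNmem _ ha2) (hNmem _ hb2), add_zero,
      ← lie_skew a1 b2]
    exact add_mem (add_mem (hGG _ ha1 _ hb1) (neg_mem (hNG _ hb2 _ ha1))) (hNG _ ha2 _ hb1)
  let S : LieSubalgebra K (FM K d) :=
    { G ⊔ N with lie_mem' := fun {a b} ha hb => le_sup_right (a := G) (hlie a ha b hb) }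
  have hS : S = ⊤ := eq_top_of_gen_mem S fun i =>
    le_sup_left (b := N) (Submodule.subset_span (Set.mem_range_self i) : gen K i ∈ G)
  have hall : ∀ a, a ∈ G ⊔ N := fun a => by
    have : a ∈ S := by rw [hS]; exact LieSubalgebra.mem_top a
    exact this
  rw [eq_top_iff]
  rintro ⟨u, hu⟩ -
  suffices h : u ∈ N by
    obtain ⟨v, hv, rfl⟩ := h
    exact hv
  exact mem_of_mem_derived (K := K) N (fun a b => hlie a (hall a) b (hall b)) hu

/-! ### Injectivity of the embedding -/

variable (K) in
/-- The map `m ↦ (deg m + 1)⁻¹ ∑ k, [x_i, x_k] ∂m/∂x_k` on monomials `m`; summed over `i`, it is a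
left inverse of `commEmb` in characteristic `0`. -/
def homotopy (i : Fin d) : MvPolynomial (Fin d) K →ₗ[K] Comm K d :=
  (basisMonomials (Fin d) K).constr K fun α =>
    ((α.degree : K) + 1)⁻¹ • ∑ k, pderiv k (monomial α (1 : K)) • genLie K i k

theorem homotopy_monomial (i : Fin d) (α : Fin d →₀ ℕ) :
    homotopy K i (monomial α 1) =
      ((α.degree : K) + 1)⁻¹ • ∑ k, pderiv k (monomial α (1 : K)) • genLie K i k := by
  have h := (basisMonomials (Fin d) K).constr_basis K (fun α =>
    ((α.degree : K) + 1)⁻¹ • ∑ k, pderiv k (monomial α (1 : K)) • genLie K i k) α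
  rwa [coe_basisMonomials] at h

theorem homotopy_X_mul_monomial (i j : Fin d) (α : Fin d →₀ ℕ) :
    homotopy K i (X j * monomial α 1) = ((α.degree : K) + 2)⁻¹ •
      (monomial α (1 : K) • genLie K i j
        + ∑ k, pderiv k (monomial α (1 : K)) • (X j : MvPolynomial (Fin d) K) • genLie K i k) := by
  have h1 : (X j * monomial α 1 : MvPolynomial (Fin d) K) = monomial (α + Finsupp.single j 1) 1 := by
    rw [X, monomial_mul, mul_one, add_comm]
  rw [h1, homotopy_monomial, ← h1]
  congr 1
  · rw [map_add, Finsupp.degree_single]; push_cast; ring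
  · simp only [Derivation.leibniz, pderiv_X, smul_eq_mul, add_smul, Finset.sum_add_distrib]
    rw [add_comm]
    congr 1
    · rw [Finset.sum_eq_single j (fun k _ hk => by
        rw [Pi.single_eq_of_ne hk.symm, mul_zero, zero_smul]) (fun h => absurd (Finset.mem_univ _) h),
        Pi.single_eq_same, mul_one]
    · refine Finset.sum_congr rfl fun k _ => ?_
      rw [mul_comm, mul_smul]

theorem sum_homotopy_commEmb_genLie (v : MvPolynomial (Fin d) K) (i j : Fin d) :
    ∑ l, homotopy K l (commEmb K d (v • genLie K i j) l)
      = homotopy K i (X j * v) - homotopy K j (X i * v) := by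
  have h : ∀ (i : Fin d) (w : MvPolynomial (Fin d) K),
      ∑ l, homotopy K l ((w • Pi.single i (1 : MvPolynomial (Fin d) K) :
        Fin d → MvPolynomial (Fin d) K) l) = homotopy K i w := by
    intro i w
    rw [Finset.sum_eq_single i (fun l _ hl => by
        rw [Pi.smul_apply, Pi.single_eq_of_ne hl, smul_zero, map_zero])
      (fun h => absurd (Finset.mem_univ _) h), Pi.smul_apply, Pi.single_eq_same, smul_eq_mul,
      mul_one]
  rw [← h i, ← h j, ← Finset.sum_sub_distrib]
  refine Finset.sum_congr rfl fun l _ => ?_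
  rw [← map_sub, map_smul, commEmb_genLie, smul_sub, smul_smul, smul_smul, mul_comm v, mul_comm v]
  rfl

theorem sum_X_mul_pderiv_monomial (α : Fin d →₀ ℕ) :
    ∑ k, pderiv k (monomial α (1 : K)) * X k
      = ((α.degree : K)) • (monomial α (1 : K) : MvPolynomial (Fin d) K) := by
  have h := (isHomogeneous_monomial (1 : K) (rfl : α.degree = α.degree)).sum_X_mul_pderiv
  rw [Nat.cast_smul_eq_nsmul, ← h]
  exact Finset.sum_congr rfl fun k _ => mul_comm _ _

/-- `∑ i, homotopy K i` is a left inverse of `commEmb`: on a monomial multiple `m [x_i, x_j]` of degree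
`n + 2` the Jacobi identity and Euler's formula produce the factor `2 + n`, where `n = deg m`. -/
theorem sum_homotopy_commEmb [CharZero K] (u : Comm K d) :
    ∑ l, homotopy K l (commEmb K d u l) = u := by
  have hu : u ∈ Submodule.span (MvPolynomial (Fin d) K)
      (Set.range fun ij : Fin d × Fin d => genLie K ij.1 ij.2) := by
    rw [span_genLie]; trivial
  suffices h : ∀ v : MvPolynomial (Fin d) K, ∑ l, homotopy K l (commEmb K d (v • u) l) = v • u by
    simpa using h 1
  induction hu using Submodule.span_induction with
  | zero => simp
  | add x y _ _ hx hy =>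
    intro v
    simp only [smul_add, map_add, Pi.add_apply, Finset.sum_add_distrib, hx, hy]
  | smul t x _ hx => intro v; rw [smul_smul, hx]
  | mem x hx =>
    obtain ⟨⟨i, j⟩, rfl⟩ := hx
    intro v
    rw [sum_homotopy_commEmb_genLie]
    induction v using MvPolynomial.induction_on' with
    | add p q hp hq =>
      rw [mul_add, mul_add, map_add, map_add, add_smul, ← hp, ← hq]; abel
    | monomial α c =>
      have hc : (monomial α c : MvPolynomial (Fin d) K) = c • monomial α 1 := by
        rw [smul_monomial, smul_eq_mul, mul_one]
      have hne : (α.degree : K) + 2 ≠ 0 := by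
        exact_mod_cast Nat.succ_ne_zero (α.degree + 1)
      rw [hc, mul_smul_comm, mul_smul_comm, map_smul, map_smul, ← smul_sub, smul_assoc]
      congr 1
      have hskew : genLie K j i = -genLie K i j := Subtype.ext (lie_skew _ _).symm
      have hsum : ∑ k, pderiv k (monomial α (1 : K)) • (X j : MvPolynomial (Fin d) K) • genLie K i k
          - ∑ k, pderiv k (monomial α (1 : K)) • (X i : MvPolynomial (Fin d) K) • genLie K j k
          = (α.degree : K) • monomial α (1 : K) • genLie K i j := by
        rw [← smul_assoc, ← sum_X_mul_pderiv_monomial, Finset.sum_smul, ← Finset.sum_sub_distrib]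
        refine Finset.sum_congr rfl fun k _ => ?_
        rw [mul_smul, X_smul_genLie i j k, smul_sub]
      rw [homotopy_X_mul_monomial, homotopy_X_mul_monomial, ← smul_sub, hskew, smul_neg,
        inv_smul_eq_iff₀ hne, add_smul, ← hsum, two_smul]
      abel

theorem commEmb_injective [CharZero K] : Function.Injective (commEmb K d) := by
  intro u v h
  rw [← sum_homotopy_commEmb u, ← sum_homotopy_commEmb v, h]

end Magnus

/-! ### The relations between the ten generators -/

section Relations

variable (K : Type*) [Field K]

theorem commEmb_br (i j : Fin 6) :
    commEmb K 6 (br K i j) = X j • Pi.single i 1 - X i • Pi.single j 1 :=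
  commEmb_genLie i j

/-- A commutator of weight three is a multiple of a commutator of the generators. -/
theorem br3_eq (i j k : Fin 6) : br3 K i j k = (X k : MvPolynomial (Fin 6) K) • br K i j :=
  Subtype.ext (coe_X_smul k (br K i j)).symm

theorem commEmb_c1 : commEmb K 6 (c1 K) = ![-X 2, 0, X 0, 0, 0, 0] := by
  funext l; fin_cases l <;> simp [c1, commEmb_br]
theorem commEmb_c2 : commEmb K 6 (c2 K) = ![-X 4, 0, 0, 0, X 0, 0] := by
  funext l; fin_cases l <;> simp [c2, commEmb_br]
theorem commEmb_c3 : commEmb K 6 (c3 K) = ![0, 0, -X 4, 0, X 2, 0] := by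
  funext l; fin_cases l <;> simp [c3, commEmb_br]
theorem commEmb_c4 : commEmb K 6 (c4 K) = ![-X 1, X 0, 0, 0, 0, 0] := by
  funext l; fin_cases l <;> simp [c4, commEmb_br]
theorem commEmb_c5 : commEmb K 6 (c5 K) = ![0, 0, -X 3, X 2, 0, 0] := by
  funext l; fin_cases l <;> simp [c5, commEmb_br]
theorem commEmb_c6 : commEmb K 6 (c6 K) = ![0, 0, 0, 0, -X 5, X 4] := by
  funext l; fin_cases l <;> simp [c6, commEmb_br]
theorem commEmb_c7 : commEmb K 6 (c7 K) = ![-X 3, X 2, -X 1, X 0, 0, 0] := by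
  funext l; fin_cases l <;> simp [c7, commEmb_br]
theorem commEmb_c8 : commEmb K 6 (c8 K) = ![-X 5, X 4, 0, 0, -X 1, X 0] := by
  funext l; fin_cases l <;> simp [c8, commEmb_br]
theorem commEmb_c9 : commEmb K 6 (c9 K) = ![0, 0, -X 5, X 4, -X 3, X 2] := by
  funext l; fin_cases l <;> simp [c9, commEmb_br]
theorem commEmb_c10 : commEmb K 6 (c10 K) = ![0, 0, X 1 * X 4, -X 0 * X 4,
    X 0 * X 3 - X 1 * X 2, 0] := by
  funext l; fin_cases l <;> simp [c10, br3_eq, commEmb_br] <;> ring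

variable {K} in
theorem comm_ext [CharZero K] {u v : Comm K 6} (h : ∀ l, commEmb K 6 u l = commEmb K 6 v l) :
    u = v :=
  commEmb_injective (_root_.funext h)

set_option maxHeartbeats 4000000 in
/-- The relations are polynomial identities between the coordinates in the free module, into which the
commutator ideal embeds. -/
theorem generator_relations [CharZero K] :
    (f1 K) • c3 K = -((f3 K) • c1 K) + (f2 K) • c2 K ∧
    (f4 K) • c1 K = -((f2 K ^ 2) • c4 K) - (f1 K ^ 2) • c5 K + (f1 K * f2 K) • c7 K ∧
    (f5 K) • c1 K = -((f4 K) • c2 K) - (2 * f2 K * f3 K) • c4 K + (f1 K * f3 K) • c7 K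
      + (f1 K * f2 K) • c8 K - (f1 K ^ 2) • c9 K ∧
    (f4 K) • c3 K = -((f6 K) • c1 K) + (2 * f1 K * f3 K) • c5 K - (f2 K * f3 K) • c7 K
      + (f2 K ^ 2) • c8 K - (f1 K * f2 K) • c9 K ∧
    (f5 K) • c3 K = -((f6 K) • c2 K) - (2 * f1 K * f2 K) • c6 K - (f3 K ^ 2) • c7 K
      + (f2 K * f3 K) • c8 K + (f1 K * f3 K) • c9 K ∧
    (f6 K) • c3 K = -((f3 K ^ 2) • c5 K) - (f2 K ^ 2) • c6 K + (f2 K * f3 K) • c9 K ∧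
    (f5 K) • c2 K = -((f3 K ^ 2) • c4 K) - (f1 K ^ 2) • c6 K + (f1 K * f3 K) • c8 K ∧
    (f1 K) • c10 K = -((f5 K) • c1 K) - (f2 K * f3 K) • c4 K + (f1 K * f2 K) • c8 K
      - (f1 K ^ 2) • c9 K ∧
    (f2 K) • c10 K = -((f6 K) • c1 K) + (f1 K * f3 K) • c5 K - (f2 K * f3 K) • c7 K
      + (f2 K ^ 2) • c8 K - (f1 K * f2 K) • c9 K ∧
    (f3 K) • c10 K = -((f6 K) • c2 K) - (f1 K * f2 K) • c6 K - (f3 K ^ 2) • c7 K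
      + (f2 K * f3 K) • c8 K ∧
    (f1 K * f6 K) • c1 K = -((f2 K * f4 K) • c2 K) - (f2 K ^ 2 * f3 K) • c4 K
      + (f1 K ^ 2 * f3 K) • c5 K + (f1 K * f2 K ^ 2) • c8 K - (f1 K ^ 2 * f2 K) • c9 K ∧
    (f3 K * f6 K) • c1 K = (f2 K * f6 K) • c2 K + (f1 K * f3 K ^ 2) • c5 K
      + (f1 K * f2 K ^ 2) • c6 K - (f1 K * f2 K * f3 K) • c9 K ∧
    (f1 K * f6 K) • c2 K = -((f3 K * f4 K) • c2 K) - (f2 K * f3 K ^ 2) • c4 K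
      - (f1 K ^ 2 * f2 K) • c6 K + (f1 K * f2 K * f3 K) • c8 K ∧
    (f4 K) • c10 K = (f2 K * f6 K) • c4 K
      + (f1 K * f5 K) • c5 K - ((f1 K * f6 K + f3 K * f4 K)) • c7 K + (f2 K * f4 K) • c8 K
      - (f1 K * f4 K) • c9 K ∧
    (f5 K) • c10 K = (f3 K * f6 K) • c4 K - (f1 K * f4 K) • c6 K - (f3 K * f5 K) • c7 K
      + (f3 K * f4 K) • c8 K ∧
    (f6 K) • c10 K = -((f3 K * f5 K) • c5 K) - (f2 K * f4 K) • c6 K + (f3 K * f4 K) • c9 K ∧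
    (f6 K ^ 2) • c1 K = (f3 K * (f3 K * f4 K + 2 * f1 K * f6 K)) • c5 K
      + (f2 K ^ 2 * f4 K) • c6 K - (f2 K * f3 K * f6 K) • c7 K + (f2 K ^ 2 * f6 K) • c8 K
      - (f2 K * (f3 K * f4 K + f1 K * f6 K)) • c9 K ∧
    (f4 K ^ 2) • c2 K = (f2 K * (-f3 K * f4 K + f1 K * f6 K)) • c4 K
      + (f1 K ^ 2 * f5 K) • c5 K - (f1 K ^ 2 * f6 K) • c7 K + (f1 K * f2 K * f4 K) • c8 K
      - (f1 K ^ 2 * f4 K) • c9 K ∧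
    (f4 K * f6 K) • c2 K = -((f2 K * f3 K * f6 K) • c4 K) - (f1 K * f3 K * f5 K) • c5 K
      - (f1 K * f2 K * f4 K) • c6 K + (f1 K * f3 K * f6 K) • c7 K
      + (f1 K * f3 K * f4 K) • c9 K ∧
    (f6 K ^ 2) • c2 K = (f3 K ^ 2 * f5 K) • c5 K + (f2 K * (f3 K * f4 K - f1 K * f6 K)) • c6 K
      - (f3 K ^ 2 * f6 K) • c7 K + (f2 K * f3 K * f6 K) • c8 K - (f3 K ^ 2 * f4 K) • c9 K ∧
    (f6 K ^ 2) • c4 K = -((f5 K ^ 2) • c5 K) - (f4 K ^ 2) • c6 K + (f5 K * f6 K) • c7 K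
      - (f4 K * f6 K) • c8 K + (f4 K * f5 K) • c9 K := by
  refine ⟨?_, ?_, ?_, ?_, ?_, ?_, ?_, ?_, ?_, ?_, ?_, ?_, ?_, ?_, ?_, ?_, ?_, ?_, ?_, ?_, ?_⟩ <;>
  refine comm_ext fun l => ?_ <;>
  simp only [map_add, map_sub, map_neg, map_smul, commEmb_c1, commEmb_c2, commEmb_c3, commEmb_c4,
    commEmb_c5, commEmb_c6, commEmb_c7, commEmb_c8, commEmb_c9, commEmb_c10] <;>
  fin_cases l <;>
  simp [f1, f2, f3, f4, f5, f6] <;> ring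

end Relations

/-! ### A second basis, adapted to multiplication by `x₁` -/

section Fibre

variable {K R V ι : Type*} [Field K] [CommRing R] [Algebra K R] [AddCommGroup V] [Module R V]
  [Module K V] [IsScalarTower K R V]

/-- A family `e i • w (π i)` is linearly independent if the family `e` is so on every fibre of `π`, and
the elements `w j` satisfy no relation whose coefficients lie in given subspaces `S j` that contain the
corresponding `e i`. -/
theorem linearIndepOn_smul_of_fibre {n : ℕ} (π : ι → Fin n) (e : ι → R) (w : Fin n → V)
    (S : Fin n → Submodule K R) (s : Set ι) (heS : ∀ i ∈ s, e i ∈ S (π i))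
    (hfib : ∀ j, LinearIndepOn K e {i | i ∈ s ∧ π i = j})
    (hrel : ∀ p : Fin n → R, (∀ j, p j ∈ S j) → ∑ j, p j • w j = 0 → ∀ j, p j = 0) :
    LinearIndepOn K (fun i => e i • w (π i)) s := by
  classical
  rw [linearIndepOn_iff]
  intro l hl h0
  rw [Finsupp.mem_supported] at hl
  have hp := hrel (fun j => Finsupp.linearCombination K e (l.filter (π · = j))) (fun j => by
      rw [Finsupp.linearCombination_apply]
      refine Submodule.finsuppSum_mem _ _ _ _ fun i hi => Submodule.smul_mem _ _ ?_
      have h1 : i ∈ (l.filter (π · = j)).support := Finsupp.mem_support_iff.2 hi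
      rw [Finsupp.support_filter, Finset.mem_filter] at h1
      rw [← h1.2]
      exact heS i (hl h1.1)) (by
    rw [← h0, Finsupp.linearCombination_apply, Finsupp.sum,
      ← Finset.sum_fiberwise l.support π]
    refine Finset.sum_congr rfl fun j _ => ?_
    rw [Finsupp.linearCombination_apply, Finsupp.sum, Finset.sum_smul, Finsupp.support_filter]
    refine Finset.sum_congr rfl fun i hi => ?_
    rw [Finset.mem_filter] at hi
    rw [Finsupp.filter_apply_pos (π · = j) l hi.2, smul_assoc, hi.2])
  ext i
  by_cases hi : i ∈ l.support
  · have h1 : l.filter (π · = π i) = 0 := by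
      refine linearIndepOn_iff.1 (hfib (π i)) _ ?_ (hp (π i))
      rw [Finsupp.mem_supported]
      intro k hk
      rw [Finset.mem_coe, Finsupp.support_filter, Finset.mem_filter] at hk
      exact ⟨hl hk.1, hk.2⟩
    rw [← Finsupp.filter_apply_pos (π · = π i) l rfl, h1]
  · simpa using hi

end Fibre

section Independence

variable (K : Type*) [Field K]

/-- The substitution `x_i = 0` in `K[a, b, t, z]`. -/
def kill (i : Fin 4) : MvPolynomial (Fin 4) K →ₐ[K] MvPolynomial (Fin 4) K :=
  aeval (Function.update X i 0)

@[simp] theorem kill_X_self (i : Fin 4) : kill K i (X i) = 0 := by simp [kill]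

theorem kill_X_of_ne {i j : Fin 4} (h : j ≠ i) : kill K i (X j) = X j := by simp [kill, h]

/-- The polynomials in `K[a, b, t, z]` that do not contain the variable `x_i`. -/
def without (i : Fin 4) : Submodule K (MvPolynomial (Fin 4) K) :=
  LinearMap.eqLocus (kill K i).toLinearMap LinearMap.id

theorem mem_without {i : Fin 4} {p : MvPolynomial (Fin 4) K} :
    p ∈ without K i ↔ kill K i p = p := Iff.rfl

/-- The specialized generators satisfy no relation whose coefficients at `c₁`, at `c₂`, `c₃`, `c₁₀`, and
at `c₄` belong to `K[a]`, to `K[a, b]`, and to `K[a, b, t] + z K[a, b, t]`, respectively. The five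
hypotheses on sums are the coordinates of such a relation, except the third one. -/
theorem eq_zero_of_specialized_relation {p1 p2 p3 q0 q1 p5 p6 p7 p8 p9 p10 : MvPolynomial (Fin 4) K}
    (h1b : kill K 1 p1 = p1) (h1t : kill K 2 p1 = p1) (h1z : kill K 3 p1 = p1)
    (h2t : kill K 2 p2 = p2) (h2z : kill K 3 p2 = p2)
    (h3t : kill K 2 p3 = p3) (h3z : kill K 3 p3 = p3)
    (h10t : kill K 2 p10 = p10) (h10z : kill K 3 p10 = p10)
    (hq0 : kill K 3 q0 = q0) (hq1 : kill K 3 q1 = q1)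
    (e1 : -(X 0 * p1) - X 1 * p2 + X 2 * (q0 + X 3 * q1) - X 3 * p8 = 0)
    (e2 : X 0 * p7 + X 1 * p8 = 0)
    (e4 : X 0 * p5 + X 1 * p9 = 0)
    (e5 : X 0 * p3 - X 3 * p6 + X 2 * p8 + X 0 * X 2 * p10 = 0)
    (e6 : X 1 * p6 + X 0 * p9 = 0) :
    p1 = 0 ∧ p2 = 0 ∧ p3 = 0 ∧ q0 + X 3 * q1 = 0 ∧ p5 = 0 ∧ p6 = 0 ∧ p7 = 0 ∧ p8 = 0 ∧ p9 = 0 ∧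
      p10 = 0 := by
  have k01 : kill K 1 (X 0) = X 0 := kill_X_of_ne K (by decide)
  have k02 : kill K 2 (X 0) = X 0 := kill_X_of_ne K (by decide)
  have k03 : kill K 3 (X 0) = X 0 := kill_X_of_ne K (by decide)
  have k12 : kill K 2 (X 1) = X 1 := kill_X_of_ne K (by decide)
  have k13 : kill K 3 (X 1) = X 1 := kill_X_of_ne K (by decide)
  have k23 : kill K 3 (X 2) = X 2 := kill_X_of_ne K (by decide)
  have cancel : ∀ (i : Fin 4) {p : MvPolynomial (Fin 4) K}, X i * p = 0 → p = 0 :=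
    fun i p h => (mul_eq_zero.1 h).resolve_left (X_ne_zero i)
  -- The combination `t e₁ + z e₅` eliminates `p₈`; it is compared in degrees `0` and `1` in `z`.
  have E : X 2 * (-(X 0 * p1) - X 1 * p2 + X 2 * q0)
      + X 3 * (X 2 * X 2 * q1 + X 0 * p3 + X 0 * X 2 * p10 - X 3 * p6) = 0 := by
    linear_combination X 2 * e1 + X 3 * e5
  have E0 : X 2 * (-(X 0 * p1) - X 1 * p2 + X 2 * q0) = 0 := by
    have h := congrArg (kill K 3) E
    simpa only [map_add, map_sub, map_neg, map_mul, map_zero, kill_X_self, h1z, h2z, hq0, k03, k13,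
      k23, zero_mul, add_zero] using h
  rw [E0, zero_add] at E
  have E' := cancel 3 E
  have E1 : X 2 * X 2 * q1 + X 0 * p3 + X 0 * X 2 * p10 = 0 := by
    have h := congrArg (kill K 3) E'
    simpa only [map_add, map_sub, map_mul, map_zero, kill_X_self, h3z, h10z, hq1, k03, k13, k23,
      zero_mul, sub_zero] using h
  have z6 : p6 = 0 := cancel 3 (by linear_combination E1 - E')
  have z3 : p3 = 0 := by
    have h := congrArg (kill K 2) E1
    exact cancel 0 (by simpa only [map_add, map_mul, map_zero, kill_X_self, h3t, k02, zero_mul,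
      mul_zero, zero_add, add_zero] using h)
  have E2 : X 2 * q1 + X 0 * p10 = 0 := cancel 2 (by rw [z3] at E1; linear_combination E1)
  have z10 : p10 = 0 := by
    have h := congrArg (kill K 2) E2
    exact cancel 0 (by simpa only [map_add, map_mul, map_zero, kill_X_self, h10t, k02, zero_mul,
      zero_add] using h)
  have zq1 : q1 = 0 := cancel 2 (by rw [z10] at E2; linear_combination E2)
  have E3 := cancel 2 E0
  have E4 : X 0 * p1 + X 1 * p2 = 0 := by
    have h := congrArg (kill K 2) E3
    simp only [map_add, map_sub, map_neg, map_mul, map_zero, kill_X_self, h1t, h2t, k02, k12,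
      zero_mul, add_zero] at h
    linear_combination -h
  have z1 : p1 = 0 := by
    have h := congrArg (kill K 1) E4
    exact cancel 0 (by simpa only [map_add, map_mul, map_zero, kill_X_self, h1b, k01, zero_mul,
      add_zero] using h)
  have z2 : p2 = 0 := cancel 1 (by rw [z1] at E4; linear_combination E4)
  have zq0 : q0 = 0 := cancel 2 (by linear_combination E3 + E4)
  have z8 : p8 = 0 := cancel 3 (by rw [z1, z2, zq0, zq1] at e1; linear_combination -e1)
  have z9 : p9 = 0 := cancel 0 (by rw [z6] at e6; linear_combination e6)
  have z5 : p5 = 0 := cancel 0 (by rw [z9] at e4; linear_combination e4)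
  have z7 : p7 = 0 := cancel 0 (by rw [z8] at e2; linear_combination e2)
  exact ⟨z1, z2, z3, by rw [zq0, zq1]; ring, z5, z6, z7, z8, z9, z10⟩

/-- The generators `c₁, …, c₁₀`. -/
def cgen : Fin 10 → Comm K 6 :=
  ![c1 K, c2 K, c3 K, c4 K, c5 K, c6 K, c7 K, c8 K, c9 K, c10 K]

/-- The generator and the monomial that make up an element of the second basis. Compared with `commElt`,
the multiples of `c₁f₃` give way to those of `c₃f₁`, and those of `c₂f₄`, `c₂f₆`, `c₁f₆` to
multiples of `c₁₀`. -/
def newIdx : CommIdx → Fin 10 × PolyIdx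
  | .c1a q1 q2 0 => (0, .a q1 q2 0 0 0)
  | .c1a q1 q2 (q3 + 1) => (2, .a (q1 + 1) q2 q3 0 0)
  | .c1b q2 => (9, .a 0 (q2 + 1) 0 0 0)
  | .c2a q1 q2 q3 0 => (1, .a q1 q2 q3 0 0)
  | .c2a q1 q2 q3 1 => (9, .a (q1 + 1) q2 q3 0 0)
  | .c2b q2 q3 => (9, .a 0 q2 (q3 + 1) 0 0)
  | .c3a q2 q3 => (2, .a 0 q2 q3 0 0)
  | .c4a q1 q2 q3 q4 e => (3, .a q1 q2 q3 q4 e)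
  | .c4b q1 q3 q4 q5 e => (3, .b q1 q3 q4 q5 e)
  | .cja j q1 q2 q3 q4 q6 => (⟨j + 4, by omega⟩, .a q1 q2 q3 q4 q6)
  | .cjb j q1 q3 q4 q5 q6 => (⟨j + 4, by omega⟩, .b q1 q3 q4 q5 q6)
  | .c10a => (9, .a 0 0 0 0 0)

/-- Multiplication by `f₁` on the indices of the second basis. -/
def newSucc : CommIdx → CommIdx
  | .c1a q1 q2 q3 => .c1a (q1 + 1) q2 q3
  | .c1b q2 => .c2a 0 (q2 + 1) 0 1
  | .c2a q1 q2 q3 e => .c2a (q1 + 1) q2 q3 e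
  | .c2b q2 q3 => .c2a 0 q2 (q3 + 1) 1
  | .c3a q2 q3 => .c1a 0 q2 (q3 + 1)
  | .c4a q1 q2 q3 q4 e => .c4a (q1 + 1) q2 q3 q4 e
  | .c4b q1 q3 q4 q5 e => .c4b (q1 + 1) q3 q4 q5 e
  | .cja j q1 q2 q3 q4 q6 => .cja j (q1 + 1) q2 q3 q4 q6
  | .cjb j q1 q3 q4 q5 q6 => .cjb j (q1 + 1) q3 q4 q5 q6
  | .c10a => .c2a 0 0 0 1

/-- The second basis. -/
def newElt (i : CommIdx) : Comm K 6 := polyElt K (newIdx i).2 • cgen K (newIdx i).1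

set_option maxHeartbeats 1000000 in
theorem newIdx_injective : Function.Injective newIdx := by
  rintro (⟨q1, q2, _ | q3⟩ | q2 | ⟨q1, q2, q3, e⟩ | ⟨q2, q3⟩ | ⟨q2, q3⟩ | ⟨q1, q2, q3, q4, e⟩ |
    ⟨q1, q3, q4, q5, e⟩ | ⟨j, q1, q2, q3, q4, q6⟩ | ⟨j, q1, q3, q4, q5, q6⟩ | _)
    (⟨q1', q2', _ | q3'⟩ | q2' | ⟨q1', q2', q3', e'⟩ | ⟨q2', q3'⟩ | ⟨q2', q3'⟩ |
    ⟨q1', q2', q3', q4', e'⟩ | ⟨q1', q3', q4', q5', e'⟩ | ⟨j', q1', q2', q3', q4', q6'⟩ |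
    ⟨j', q1', q3', q4', q5', q6'⟩ | _) h <;>
  (try fin_cases e) <;> (try fin_cases e') <;>
  simp only [newIdx, Prod.mk.injEq, Fin.ext_iff, PolyIdx.a.injEq, PolyIdx.b.injEq, reduceCtorEq,
    CommIdx.c1a.injEq] at h ⊢ <;> first | omega | grind

theorem newIdx_newSucc (i : CommIdx) :
    newIdx (newSucc i) = ((newIdx i).1, idxSucc (newIdx i).2) := by
  rcases i with ⟨q1, q2, _ | q3⟩ | _ | ⟨q1, q2, q3, e⟩ | _ | _ | _ | _ | _ | _ | _ <;>
    (try fin_cases e) <;> rfl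

theorem newSucc_injective : Function.Injective newSucc := by
  intro i i' h
  have h' := congrArg newIdx h
  rw [newIdx_newSucc, newIdx_newSucc, Prod.mk.injEq] at h'
  exact newIdx_injective (Prod.ext h'.1 (idxSucc_injective h'.2))

theorem mem_range_newSucc {i : CommIdx} (hi : idxOne (newIdx i).2 ≠ 0) :
    i ∈ Set.range newSucc := by
  rcases i with ⟨_ | q1, q2, _ | q3⟩ | _ | ⟨_ | q1, q2, q3, e⟩ | _ | _ | ⟨_ | q1, q2, q3, q4, e⟩ |
    ⟨_ | q1, q3, q4, q5, e⟩ | ⟨j, _ | q1, q2, q3, q4, q6⟩ | ⟨j, _ | q1, q3, q4, q5, q6⟩ | _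
  all_goals first | exact absurd rfl hi | skip
  · exact ⟨.c3a q2 q3, rfl⟩
  · exact ⟨.c1a q1 q2 0, rfl⟩
  · exact ⟨.c1a q1 q2 (q3 + 1), rfl⟩
  · fin_cases e
    · exact absurd rfl hi
    · rcases q3 with _ | q3
      · rcases q2 with _ | q2
        · exact ⟨.c10a, rfl⟩
        · exact ⟨.c1b q2, rfl⟩
      · exact ⟨.c2b q2 q3, rfl⟩
  · exact ⟨.c2a q1 q2 q3 e, rfl⟩
  · exact ⟨.c4a q1 q2 q3 q4 e, rfl⟩
  · exact ⟨.c4b q1 q3 q4 q5 e, rfl⟩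
  · exact ⟨.cja j q1 q2 q3 q4 q6, rfl⟩
  · exact ⟨.cjb j q1 q3 q4 q5 q6, rfl⟩

/-- The map `commEmb` followed by the specialization of the coordinates. -/
def specEmb : Comm K 6 →ₗ[K] (Fin 6 → MvPolynomial (Fin 4) K) where
  toFun u l := specialize K (commEmb K 6 u l)
  map_add' u v := by funext l; simp
  map_smul' t u := by
    funext l
    rw [LinearMap.map_smul_of_tower, Pi.smul_apply, map_smul]; rfl

theorem specEmb_smul (p : MvPolynomial (Fin 6) K) (u : Comm K 6) :
    specEmb K (p • u) = specialize K p • specEmb K u := by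
  funext l
  change specialize K (commEmb K 6 (p • u) l) = specialize K p * specialize K (commEmb K 6 u l)
  rw [map_smul, Pi.smul_apply, smul_eq_mul, map_mul]

/-- Multiplication by `x₁`. -/
def mulX : Comm K 6 →ₗ[K] Comm K 6 where
  toFun u := (X 0 : MvPolynomial (Fin 6) K) • u
  map_add' u v := smul_add _ u v
  map_smul' t u := smul_comm _ t u

theorem mulX_apply (u : Comm K 6) : mulX K u = (X 0 : MvPolynomial (Fin 6) K) • u := rfl

theorem mulX_injective [CharZero K] : Function.Injective (mulX K) := by
  intro u v h
  refine comm_ext fun l => ?_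
  have h' := congrFun (congrArg (commEmb K 6) h) l
  rw [mulX_apply, mulX_apply, map_smul, map_smul] at h'
  exact mul_left_cancel₀ (X_ne_zero 0) h'

theorem specEmb_mulX (u : Comm K 6) : specEmb K (mulX K u) = 0 := by
  rw [mulX_apply, specEmb_smul]
  simp [specialize]

theorem newElt_newSucc (i : CommIdx) : newElt K (newSucc i) = mulX K (newElt K i) := by
  rw [newElt, newIdx_newSucc, polyElt_idxSucc, mul_smul]; rfl

/-- The subspaces that contain the specialized coefficients of the generators in the elements of the
second basis. -/
def coeffSpace : Fin 10 → Submodule K (MvPolynomial (Fin 4) K) :=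
  ![without K 1 ⊓ (without K 2 ⊓ without K 3), without K 2 ⊓ without K 3,
    without K 2 ⊓ without K 3,
    without K 3 ⊔ (without K 3).map (LinearMap.mulLeft K (X 3)), ⊤, ⊤, ⊤, ⊤, ⊤,
    without K 2 ⊓ without K 3]

theorem specMonomial_mem_coeffSpace {i : CommIdx} (hi : idxOne (newIdx i).2 = 0) :
    specMonomial K (specExp (newIdx i).2) ∈ coeffSpace K (newIdx i).1 := by
  have h1 : ∀ i j, specMonomial K (i, j, 0, 0) ∈ without K 2 ⊓ without K 3 := fun i j => by
    simp [mem_without, specMonomial, kill_X_of_ne]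
  have h2 : ∀ i j k (e : Fin 2), specMonomial K (i, j, k, e) ∈
      without K 3 ⊔ (without K 3).map (LinearMap.mulLeft K (X 3)) := fun i j k e => by
    fin_cases e
    · exact le_sup_left (α := Submodule K (MvPolynomial (Fin 4) K))
        (by simp [mem_without, specMonomial, kill_X_of_ne])
    · refine le_sup_right (α := Submodule K (MvPolynomial (Fin 4) K))
        ⟨specMonomial K (i, j, k, 0), by simp [mem_without, specMonomial, kill_X_of_ne], ?_⟩
      simp [specMonomial, mul_comm]
  rcases i with ⟨q1, q2, _ | q3⟩ | q2 | ⟨q1, q2, q3, e⟩ | ⟨q2, q3⟩ | ⟨q2, q3⟩ | ⟨q1, q2, q3, q4, e⟩ |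
    ⟨q1, q3, q4, q5, e⟩ | ⟨j, q1, q2, q3, q4, q6⟩ | ⟨j, q1, q3, q4, q5, q6⟩ | _
  · refine ⟨?_, h1 _ _⟩
    simp [mem_without, specMonomial, kill_X_of_ne, specExp, newIdx]
  · exact h1 _ _
  · exact h1 _ _
  · fin_cases e
    · exact h1 _ _
    · exact h1 _ _
  · exact h1 _ _
  · exact h1 _ _
  · exact h2 _ _ _ _
  · exact h2 _ _ _ _
  · fin_cases j <;> exact Submodule.mem_top
  · fin_cases j <;> exact Submodule.mem_top
  · exact h1 _ _

theorem eq_zero_of_sum_smul_specEmb_cgen (p : Fin 10 → MvPolynomial (Fin 4) K)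
    (hp : ∀ j, p j ∈ coeffSpace K j) (h0 : ∑ j, p j • specEmb K (cgen K j) = 0) :
    ∀ j, p j = 0 := by
  obtain ⟨h1b, h1t, h1z⟩ := hp 0
  obtain ⟨h2t, h2z⟩ := hp 1
  obtain ⟨h3t, h3z⟩ := hp 2
  obtain ⟨h10t, h10z⟩ := hp 9
  obtain ⟨q0, hq0, _, ⟨q1, hq1, rfl⟩, h4⟩ := Submodule.mem_sup.1 (hp 3)
  have h4' : p 3 = q0 + X 3 * q1 := h4.symm
  have hc : ∀ l, p 0 * specialize K (commEmb K 6 (c1 K) l) + p 1 * specialize K (commEmb K 6 (c2 K) l)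
      + p 2 * specialize K (commEmb K 6 (c3 K) l) + p 3 * specialize K (commEmb K 6 (c4 K) l)
      + p 4 * specialize K (commEmb K 6 (c5 K) l) + p 5 * specialize K (commEmb K 6 (c6 K) l)
      + p 6 * specialize K (commEmb K 6 (c7 K) l) + p 7 * specialize K (commEmb K 6 (c8 K) l)
      + p 8 * specialize K (commEmb K 6 (c9 K) l) + p 9 * specialize K (commEmb K 6 (c10 K) l)
      = 0 := fun l => by
    have h := congrFun h0 l
    rw [Finset.sum_apply] at h
    simp only [Fin.sum_univ_succ, Fin.sum_univ_zero, Pi.smul_apply, smul_eq_mul] at h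
    simp only [← add_assoc, add_zero] at h
    exact h
  simp only [commEmb_c1, commEmb_c2, commEmb_c3, commEmb_c4, commEmb_c5, commEmb_c6, commEmb_c7,
    commEmb_c8, commEmb_c9, commEmb_c10] at hc
  have e1 := hc 0
  have e2 := hc 1
  have e4 := hc 3
  have e5 := hc 4
  have e6 := hc 5
  simp [specialize] at e1 e2 e4 e5 e6
  obtain ⟨z1, z2, z3, z4, z5, z6, z7, z8, z9, z10⟩ := eq_zero_of_specialized_relation K
    h1b h1t h1z h2t h2z h3t h3z h10t h10z hq0 hq1 (p5 := p 4) (p6 := p 5) (p7 := p 6) (p8 := p 7)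
    (p9 := p 8) (by rw [← h4']; linear_combination e1) (by linear_combination e2)
    (by linear_combination e4) (by linear_combination e5) (by linear_combination e6)
  rw [← h4'] at z4
  intro j
  fin_cases j <;> assumption

theorem linearIndepOn_specEmb_newElt :
    LinearIndepOn K (specEmb K ∘ newElt K) (Set.range newSucc)ᶜ := by
  have hone : ∀ i ∈ (Set.range newSucc)ᶜ, idxOne (newIdx i).2 = 0 := fun i hi => by
    by_contra h
    exact hi (mem_range_newSucc h)
  have he : specEmb K ∘ newElt K = fun i => specialize K (polyElt K (newIdx i).2) •
      specEmb K (cgen K (newIdx i).1) :=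
    _root_.funext fun i => specEmb_smul K _ _
  rw [he]
  refine linearIndepOn_smul_of_fibre (fun i => (newIdx i).1)
    (fun i => specialize K (polyElt K (newIdx i).2)) (fun j => specEmb K (cgen K j)) (coeffSpace K)
    _ (fun i hi => ?_) (fun j => ?_) (eq_zero_of_sum_smul_specEmb_cgen K)
  · rw [specialize_polyElt K (hone i hi)]
    exact specMonomial_mem_coeffSpace K (hone i hi)
  · have h := (linearIndependent_specMonomial K).comp
      (fun i : {i | i ∈ (Set.range newSucc)ᶜ ∧ (newIdx i).1 = j} => specExp (newIdx i).2)
      (fun i i' h => Subtype.ext (newIdx_injective (Prod.ext (i.2.2.trans i'.2.2.symm)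
        (specExp_injOn (hone i i.2.1) (hone i' i'.2.1) h))))
    have he' : (fun i : {i | i ∈ (Set.range newSucc)ᶜ ∧ (newIdx i).1 = j} =>
        specialize K (polyElt K (newIdx i).2)) = specMonomial K ∘
          fun i : {i | i ∈ (Set.range newSucc)ᶜ ∧ (newIdx i).1 = j} => specExp (newIdx i).2 :=
      _root_.funext fun i => specialize_polyElt K (hone i i.2.1)
    rw [← he'] at h
    exact h

theorem linearIndependent_newElt [CharZero K] : LinearIndependent K (newElt K) :=
  linearIndependent_of_linearIndepOn_mod (mulX K) (mulX_injective K) (specEmb K) (specEmb_mulX K)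
    (newElt K) newSucc newSucc_injective (newElt_newSucc K) (fun i => idxOne (newIdx i).2)
    (fun i => by rw [newIdx_newSucc, idxOne_idxSucc]; omega) (linearIndepOn_specEmb_newElt K)

theorem mem_span_newElt_of_X_smul_mem [CharZero K] {u : Comm K 6}
    (hu : (X 0 : MvPolynomial (Fin 6) K) • u ∈ Submodule.span K (Set.range (newElt K))) :
    u ∈ Submodule.span K (Set.range (newElt K)) :=
  mem_span_of_map_mem_span (mulX K) (mulX_injective K) (specEmb K) (specEmb_mulX K)
    (newElt K) newSucc newSucc_injective (newElt_newSucc K) (linearIndepOn_specEmb_newElt K) hu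

end Independence

/-! ### The second basis spans the module of constants -/

section Spanning

variable (K : Type*) [Field K]

theorem f1_mem : f1 K ∈ polyConst (J222 K) := polyDelta_fgen K 0
theorem f2_mem : f2 K ∈ polyConst (J222 K) := polyDelta_fgen K 1
theorem f3_mem : f3 K ∈ polyConst (J222 K) := polyDelta_fgen K 2
theorem f4_mem : f4 K ∈ polyConst (J222 K) := polyDelta_fgen K 3
theorem f5_mem : f5 K ∈ polyConst (J222 K) := polyDelta_fgen K 4
theorem f6_mem : f6 K ∈ polyConst (J222 K) := polyDelta_fgen K 5

theorem polyElt_mem (m : PolyIdx) : polyElt K m ∈ polyConst (J222 K) := by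
  have h : polyElt K m ∈ Submodule.span K (Set.range (polyElt K)) :=
    Submodule.subset_span ⟨m, rfl⟩
  rw [span_polyElt] at h
  exact adjoin_fgen_le K h

/-- It suffices to multiply by the basis of the algebra of constants. -/
theorem smul_mem_of_polyElt_smul_mem [CharZero K] {S : Submodule K (Comm K 6)} {u : Comm K 6}
    (h : ∀ m, polyElt K m • u ∈ S) {p : MvPolynomial (Fin 6) K} (hp : p ∈ polyConst (J222 K)) :
    p • u ∈ S := by
  have hp' := mem_span_polyElt_of_polyDelta_eq_zero K hp
  induction hp' using Submodule.span_induction with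
  | mem x hx => obtain ⟨m, rfl⟩ := hx; exact h m
  | zero => rw [zero_smul]; exact zero_mem _
  | add x y hx hy hx' hy' =>
    rw [add_smul]
    refine add_mem (hx' ?_) (hy' ?_)
    · rw [← Subalgebra.mem_toSubmodule, ← span_polyElt_eq_polyConst]; exact hx
    · rw [← Subalgebra.mem_toSubmodule, ← span_polyElt_eq_polyConst]; exact hy
  | smul t x hx hx' =>
    rw [smul_assoc]
    refine Submodule.smul_mem _ t (hx' ?_)
    rw [← Subalgebra.mem_toSubmodule, ← span_polyElt_eq_polyConst]; exact hx

theorem newElt_mem_span (i : CommIdx) : newElt K i ∈ Submodule.span K (Set.range (newElt K)) :=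
  Submodule.subset_span ⟨i, rfl⟩

theorem smul_c5to9_mem [CharZero K] (j : Fin 5) {p : MvPolynomial (Fin 6) K}
    (hp : p ∈ polyConst (J222 K)) : p • c5to9 K j ∈ Submodule.span K (Set.range (newElt K)) := by
  refine smul_mem_of_polyElt_smul_mem K (fun m => ?_) hp
  rcases m with ⟨q1, q2, q3, q4, q6⟩ | ⟨q1, q3, q4, q5, q6⟩
  · convert newElt_mem_span K (.cja j q1 q2 q3 q4 q6) using 1
    fin_cases j <;> rfl
  · convert newElt_mem_span K (.cjb j q1 q3 q4 q5 q6) using 1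
    fin_cases j <;> rfl

theorem smul_c5_mem [CharZero K] {p : MvPolynomial (Fin 6) K} (hp : p ∈ polyConst (J222 K)) :
    p • c5 K ∈ Submodule.span K (Set.range (newElt K)) :=
  smul_c5to9_mem K 0 hp

theorem smul_c6_mem [CharZero K] {p : MvPolynomial (Fin 6) K} (hp : p ∈ polyConst (J222 K)) :
    p • c6 K ∈ Submodule.span K (Set.range (newElt K)) :=
  smul_c5to9_mem K 1 hp

theorem smul_c7_mem [CharZero K] {p : MvPolynomial (Fin 6) K} (hp : p ∈ polyConst (J222 K)) :
    p • c7 K ∈ Submodule.span K (Set.range (newElt K)) :=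
  smul_c5to9_mem K 2 hp

theorem smul_c8_mem [CharZero K] {p : MvPolynomial (Fin 6) K} (hp : p ∈ polyConst (J222 K)) :
    p • c8 K ∈ Submodule.span K (Set.range (newElt K)) :=
  smul_c5to9_mem K 3 hp

theorem smul_c9_mem [CharZero K] {p : MvPolynomial (Fin 6) K} (hp : p ∈ polyConst (J222 K)) :
    p • c9 K ∈ Submodule.span K (Set.range (newElt K)) :=
  smul_c5to9_mem K 4 hp

/-- Multiples of `c₄` by `f₆ ^ 2` are reduced by the last relation. -/
theorem smul_c4_mem [CharZero K] {p : MvPolynomial (Fin 6) K} (hp : p ∈ polyConst (J222 K)) :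
    p • c4 K ∈ Submodule.span K (Set.range (newElt K)) := by
  obtain ⟨-, -, -, -, -, -, -, -, -, -, -, -, -, -, -, -, -, -, -, -, r⟩ := generator_relations K
  have key : ∀ m, (polyElt K m * f6 K ^ 2) • c4 K ∈ Submodule.span K (Set.range (newElt K)) := by
    intro m
    have hm := polyElt_mem K m
    rw [mul_smul, r]
    simp only [smul_add, smul_sub, smul_neg, smul_smul]
    repeat' with_reducible first
      | exact hm | exact f4_mem K | exact f5_mem K | exact f6_mem K
      | apply smul_c5_mem | apply smul_c6_mem | apply smul_c7_mem | apply smul_c8_mem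
      | apply smul_c9_mem | apply mul_mem | apply pow_mem | apply add_mem | apply sub_mem
      | apply neg_mem
  refine smul_mem_of_polyElt_smul_mem K (fun m => ?_) hp
  rcases m with ⟨q1, q2, q3, q4, _ | _ | q6⟩ | ⟨q1, q3, q4, q5, _ | _ | q6⟩
  · exact newElt_mem_span K (.c4a q1 q2 q3 q4 0)
  · exact newElt_mem_span K (.c4a q1 q2 q3 q4 1)
  · convert key (.a q1 q2 q3 q4 q6) using 2
    simp only [polyElt]; ring
  · exact newElt_mem_span K (.c4b q1 q3 q4 q5 0)
  · exact newElt_mem_span K (.c4b q1 q3 q4 q5 1)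
  · convert key (.b q1 q3 q4 q5 q6) using 2
    simp only [polyElt]; ring

/-- Products with `f₄`, `f₅`, `f₆` of the generators `c₁`, `c₂`, `c₃`, expressed by `c₁₀`. -/
theorem generator_reductions [CharZero K] :
    (f5 K) • c1 K = -((f1 K) • c10 K) - (f2 K * f3 K) • c4 K + (f1 K * f2 K) • c8 K
      - (f1 K ^ 2) • c9 K ∧
    (f6 K) • c1 K = -((f2 K) • c10 K) + (f1 K * f3 K) • c5 K - (f2 K * f3 K) • c7 K
      + (f2 K ^ 2) • c8 K - (f1 K * f2 K) • c9 K ∧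
    (f4 K) • c2 K = (f1 K) • c10 K - (f2 K * f3 K) • c4 K + (f1 K * f3 K) • c7 K ∧
    (f6 K) • c2 K = -((f3 K) • c10 K) - (f1 K * f2 K) • c6 K - (f3 K ^ 2) • c7 K
      + (f2 K * f3 K) • c8 K ∧
    (f4 K) • c3 K = (f2 K) • c10 K + (f1 K * f3 K) • c5 K ∧
    (f5 K) • c3 K = (f3 K) • c10 K - (f1 K * f2 K) • c6 K + (f1 K * f3 K) • c9 K := by
  obtain ⟨-, -, r3, r4, r5, -, -, r8, r9, r10, -⟩ := generator_relations K
  refine ⟨?_, ?_, ?_, ?_, ?_, ?_⟩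
  · rw [r8]; module
  · rw [r9]; module
  · rw [r3] at r8; rw [r8]; module
  · rw [r10]; module
  · rw [r4, r9]; module
  · rw [r5, r10]; module

/-- The monomials in `f₁`, `f₂`, `f₃`. -/
def mono (q1 q2 q3 : ℕ) : MvPolynomial (Fin 6) K := f1 K ^ q1 * f2 K ^ q2 * f3 K ^ q3

theorem mono_mem (q1 q2 q3 : ℕ) : mono K q1 q2 q3 ∈ polyConst (J222 K) :=
  mul_mem (mul_mem (pow_mem (f1_mem K) _) (pow_mem (f2_mem K) _)) (pow_mem (f3_mem K) _)

theorem mono_eq_polyElt (q1 q2 q3 : ℕ) : mono K q1 q2 q3 = polyElt K (.a q1 q2 q3 0 0) := by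
  simp [mono, polyElt]

theorem mono_mul_f1 (q1 q2 q3 : ℕ) : mono K q1 q2 q3 * f1 K = mono K (q1 + 1) q2 q3 := by
  simp only [mono]; ring
theorem mono_mul_f2 (q1 q2 q3 : ℕ) : mono K q1 q2 q3 * f2 K = mono K q1 (q2 + 1) q3 := by
  simp only [mono]; ring
theorem mono_mul_f3 (q1 q2 q3 : ℕ) : mono K q1 q2 q3 * f3 K = mono K q1 q2 (q3 + 1) := by
  simp only [mono]; ring

theorem mono_smul_c2_mem (q1 q2 q3 : ℕ) :
    mono K q1 q2 q3 • c2 K ∈ Submodule.span K (Set.range (newElt K)) := by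
  rw [mono_eq_polyElt]
  exact newElt_mem_span K (.c2a q1 q2 q3 0)

theorem mono_smul_c3_mem (q1 q2 q3 : ℕ) :
    mono K q1 q2 q3 • c3 K ∈ Submodule.span K (Set.range (newElt K)) := by
  rw [mono_eq_polyElt]
  rcases q1 with _ | q1
  · exact newElt_mem_span K (.c3a q2 q3)
  · exact newElt_mem_span K (.c1a q1 q2 (q3 + 1))

theorem mono_smul_c10_mem (q1 q2 q3 : ℕ) :
    mono K q1 q2 q3 • c10 K ∈ Submodule.span K (Set.range (newElt K)) := by
  rw [mono_eq_polyElt]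
  rcases q1 with _ | q1
  · rcases q3 with _ | q3
    · rcases q2 with _ | q2
      · exact newElt_mem_span K .c10a
      · exact newElt_mem_span K (.c1b q2)
    · exact newElt_mem_span K (.c2b q2 q3)
  · exact newElt_mem_span K (.c2a q1 q2 q3 1)

theorem mono_smul_c1_mem [CharZero K] (q1 q2 q3 : ℕ) :
    mono K q1 q2 q3 • c1 K ∈ Submodule.span K (Set.range (newElt K)) := by
  rcases q3 with _ | q3
  · rw [mono_eq_polyElt]
    exact newElt_mem_span K (.c1a q1 q2 0)
  · obtain ⟨r, -⟩ := generator_relations K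
    have h : f3 K • c1 K = f2 K • c2 K - f1 K • c3 K := by rw [r]; abel
    rw [← mono_mul_f3, mul_smul, h, smul_sub, smul_smul, smul_smul, mono_mul_f1, mono_mul_f2]
    exact sub_mem (mono_smul_c2_mem K _ _ _) (mono_smul_c3_mem K _ _ _)

/-- The products of `f₄`, `f₅`, `f₆` with `c₁`, `c₂`, `c₃`, `c₁₀` lie in the span of the multiples of
`c₄, …, c₉` and of `f₁c₁₀`, `f₂c₁₀`, `f₃c₁₀`. -/
theorem mono_smul_fgen_smul_mem [CharZero K] (q1 q2 q3 : ℕ) (i : Fin 6) {c : Comm K 6}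
    (hc : c = c1 K ∨ c = c2 K ∨ c = c3 K ∨ c = c10 K) :
    mono K q1 q2 q3 • fgen K i • c ∈ Submodule.span K (Set.range (newElt K)) := by
  have hmono : ∀ q1 q2 q3, mono K q1 q2 q3 • c ∈ Submodule.span K (Set.range (newElt K)) := by
    intro q1 q2 q3
    rcases hc with rfl | rfl | rfl | rfl
    · exact mono_smul_c1_mem K _ _ _
    · exact mono_smul_c2_mem K _ _ _
    · exact mono_smul_c3_mem K _ _ _
    · exact mono_smul_c10_mem K _ _ _
  have hm := mono_mem K q1 q2 q3
  have k1 := mono_smul_c10_mem K (q1 + 1) q2 q3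
  have k2 := mono_smul_c10_mem K q1 (q2 + 1) q3
  have k3 := mono_smul_c10_mem K q1 q2 (q3 + 1)
  rw [← mono_mul_f1] at k1
  rw [← mono_mul_f2] at k2
  rw [← mono_mul_f3] at k3
  obtain ⟨-, r42, -, -, -, r63, r52, -, -, -, -, -, -, r4, r5, r6, -⟩ := generator_relations K
  obtain ⟨s51, s61, s42, s62, s43, s53⟩ := generator_reductions K
  fin_cases i
  · rw [smul_smul]
    change (mono K q1 q2 q3 * f1 K) • c ∈ _
    rw [mono_mul_f1]; exact hmono _ _ _
  · rw [smul_smul]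
    change (mono K q1 q2 q3 * f2 K) • c ∈ _
    rw [mono_mul_f2]; exact hmono _ _ _
  · rw [smul_smul]
    change (mono K q1 q2 q3 * f3 K) • c ∈ _
    rw [mono_mul_f3]; exact hmono _ _ _
  · change mono K q1 q2 q3 • f4 K • c ∈ _
    rcases hc with rfl | rfl | rfl | rfl
    on_goal 1 => rw [r42]
    on_goal 2 => rw [s42]
    on_goal 3 => rw [s43]
    on_goal 4 => rw [r4]
    all_goals
      simp only [smul_add, smul_sub, smul_neg, smul_smul]
      repeat' with_reducible first
        | exact hm | exact f1_mem K | exact f2_mem K | exact f3_mem K | exact f4_mem K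
        | exact f5_mem K | exact f6_mem K | exact k1 | exact k2 | exact k3
        | apply smul_c4_mem | apply smul_c5_mem | apply smul_c6_mem | apply smul_c7_mem
        | apply smul_c8_mem | apply smul_c9_mem | apply mul_mem | apply pow_mem
        | apply add_mem | apply sub_mem | apply neg_mem
  · change mono K q1 q2 q3 • f5 K • c ∈ _
    rcases hc with rfl | rfl | rfl | rfl
    on_goal 1 => rw [s51]
    on_goal 2 => rw [r52]
    on_goal 3 => rw [s53]
    on_goal 4 => rw [r5]
    all_goals
      simp only [smul_add, smul_sub, smul_neg, smul_smul]
      repeat' with_reducible first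
        | exact hm | exact f1_mem K | exact f2_mem K | exact f3_mem K | exact f4_mem K
        | exact f5_mem K | exact f6_mem K | exact k1 | exact k2 | exact k3
        | apply smul_c4_mem | apply smul_c5_mem | apply smul_c6_mem | apply smul_c7_mem
        | apply smul_c8_mem | apply smul_c9_mem | apply mul_mem | apply pow_mem
        | apply add_mem | apply sub_mem | apply neg_mem
  · change mono K q1 q2 q3 • f6 K • c ∈ _
    rcases hc with rfl | rfl | rfl | rfl
    on_goal 1 => rw [s61]
    on_goal 2 => rw [s62]
    on_goal 3 => rw [r63]
    on_goal 4 => rw [r6]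
    all_goals
      simp only [smul_add, smul_sub, smul_neg, smul_smul]
      repeat' with_reducible first
        | exact hm | exact f1_mem K | exact f2_mem K | exact f3_mem K | exact f4_mem K
        | exact f5_mem K | exact f6_mem K | exact k1 | exact k2 | exact k3
        | apply smul_c4_mem | apply smul_c5_mem | apply smul_c6_mem | apply smul_c7_mem
        | apply smul_c8_mem | apply smul_c9_mem | apply mul_mem | apply pow_mem
        | apply add_mem | apply sub_mem | apply neg_mem

theorem fgen_smul_newElt_mem [CharZero K] (i : Fin 6) (x : CommIdx) :
    fgen K i • newElt K x ∈ Submodule.span K (Set.range (newElt K)) := by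
  have h : ∀ (q1 q2 q3 : ℕ) {c : Comm K 6}, (c = c1 K ∨ c = c2 K ∨ c = c3 K ∨ c = c10 K) →
      fgen K i • polyElt K (.a q1 q2 q3 0 0) • c ∈ Submodule.span K (Set.range (newElt K)) := by
    intro q1 q2 q3 c hc
    rw [← mono_eq_polyElt, smul_comm]
    exact mono_smul_fgen_smul_mem K q1 q2 q3 i hc
  have hA : ∀ m, fgen K i * polyElt K m ∈ polyConst (J222 K) :=
    fun m => mul_mem (polyDelta_fgen K i) (polyElt_mem K m)
  rcases x with ⟨q1, q2, _ | q3⟩ | q2 | ⟨q1, q2, q3, e⟩ | ⟨q2, q3⟩ | ⟨q2, q3⟩ | ⟨q1, q2, q3, q4, e⟩ |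
    ⟨q1, q3, q4, q5, e⟩ | ⟨j, q1, q2, q3, q4, q6⟩ | ⟨j, q1, q3, q4, q5, q6⟩ | _
  · exact h _ _ _ (Or.inl rfl)
  · exact h _ _ _ (Or.inr (Or.inr (Or.inl rfl)))
  · exact h _ _ _ (Or.inr (Or.inr (Or.inr rfl)))
  · fin_cases e
    · exact h _ _ _ (Or.inr (Or.inl rfl))
    · exact h _ _ _ (Or.inr (Or.inr (Or.inr rfl)))
  · exact h _ _ _ (Or.inr (Or.inr (Or.inr rfl)))
  · exact h _ _ _ (Or.inr (Or.inr (Or.inl rfl)))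
  · rw [newElt, smul_smul]; exact smul_c4_mem K (hA _)
  · rw [newElt, smul_smul]; exact smul_c4_mem K (hA _)
  · rw [newElt, smul_smul]
    have h5 := smul_c5to9_mem K j (hA (.a q1 q2 q3 q4 q6))
    fin_cases j <;> exact h5
  · rw [newElt, smul_smul]
    have h5 := smul_c5to9_mem K j (hA (.b q1 q3 q4 q5 q6))
    fin_cases j <;> exact h5
  · exact h _ _ _ (Or.inr (Or.inr (Or.inr rfl)))

/-- The span of the second basis is a module over the algebra of constants. -/
theorem smul_mem_span_newElt [CharZero K] {p : MvPolynomial (Fin 6) K}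
    (hp : p ∈ polyConst (J222 K)) {u : Comm K 6}
    (hu : u ∈ Submodule.span K (Set.range (newElt K))) :
    p • u ∈ Submodule.span K (Set.range (newElt K)) := by
  rw [polyConst_eq_adjoin] at hp
  induction hp using Algebra.adjoin_induction generalizing u with
  | mem x hx =>
    obtain ⟨i, rfl⟩ := hx
    induction hu using Submodule.span_induction with
    | mem y hy => obtain ⟨j, rfl⟩ := hy; exact fgen_smul_newElt_mem K i j
    | zero => rw [smul_zero]; exact zero_mem _
    | add y z _ _ hy hz => rw [smul_add]; exact add_mem hy hz
    | smul t y _ hy => rw [smul_comm]; exact Submodule.smul_mem _ t hy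
  | algebraMap t => rw [algebraMap_smul]; exact Submodule.smul_mem _ t hu
  | add x y _ _ hx hy => rw [add_smul]; exact add_mem (hx hu) (hy hu)
  | mul x y _ _ hx hy => rw [mul_smul]; exact hx (hy hu)

theorem cgen_mem_span_newElt [CharZero K] (j : Fin 10) :
    cgen K j ∈ Submodule.span K (Set.range (newElt K)) := by
  rw [← one_smul (MvPolynomial (Fin 6) K) (cgen K j)]
  have h1 : (1 : MvPolynomial (Fin 6) K) = mono K 0 0 0 := by simp [mono]
  have h2 : (1 : MvPolynomial (Fin 6) K) ∈ polyConst (J222 K) := one_mem _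
  fin_cases j
  · rw [h1]; exact mono_smul_c1_mem K 0 0 0
  · rw [h1]; exact mono_smul_c2_mem K 0 0 0
  · rw [h1]; exact mono_smul_c3_mem K 0 0 0
  · exact smul_c4_mem K h2
  · exact smul_c5_mem K h2
  · exact smul_c6_mem K h2
  · exact smul_c7_mem K h2
  · exact smul_c8_mem K h2
  · exact smul_c9_mem K h2
  · rw [h1]; exact mono_smul_c10_mem K 0 0 0

/-! ### The derivation on the commutator ideal -/

theorem lieDelta_gen (i : Fin 6) :
    lieDelta (J222 K) (gen K i) = ![0, gen K 0, 0, gen K 2, 0, gen K 4] i := by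
  rw [lieDelta, lieDer_gen]
  fin_cases i <;> simp [J222, Fin.sum_univ_six]

theorem coe_commDelta_br (i j : Fin 6) : (commDelta (J222 K) (br K i j) : FM K 6)
    = ⁅gen K i, ![0, gen K 0, 0, gen K 2, 0, gen K 4] j⁆
      + ⁅(![0, gen K 0, 0, gen K 2, 0, gen K 4] : Fin 6 → FM K 6) i, gen K j⁆ := by
  rw [coe_commDelta]
  change lieDelta (J222 K) ⁅gen K i, gen K j⁆ = _
  rw [LieDerivation.apply_lie_eq_add, lieDelta_gen, lieDelta_gen]

theorem commDelta_br (i j : Fin 6) : commDelta (J222 K) (br K i j)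
    = ![0, br K i 0, 0, br K i 2, 0, br K i 4] j + ![0, br K 0 j, 0, br K 2 j, 0, br K 4 j] i := by
  apply Subtype.ext
  rw [coe_commDelta_br]
  fin_cases i <;> fin_cases j <;> simp [br]

theorem br_self (i : Fin 6) : br K i i = 0 := genLie_self i

theorem commDelta_cgen (j : Fin 10) : commDelta (J222 K) (cgen K j) = 0 := by
  fin_cases j <;> simp [cgen, c1, c2, c3, c4, c5, c6, c7, c8, c9, c10, br3_eq, commDelta_br,
    commDelta_smul, polyDelta_X, br_self]

end Spanning

/-! ### The constants of the commutator ideal -/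

section ConstantsOfIdeal

variable (K : Type*) [Field K]

/-- By the Jacobi identity, `x₁` maps the commutator ideal into the submodule generated by the
`[x_i, x₁]`. -/
theorem X_smul_mem_span_br (u : Comm K 6) : (X 0 : MvPolynomial (Fin 6) K) • u ∈
    Submodule.span (MvPolynomial (Fin 6) K) (Set.range fun i => br K i 0) := by
  have hu : u ∈ Submodule.span (MvPolynomial (Fin 6) K)
      (Set.range fun ij : Fin 6 × Fin 6 => genLie K ij.1 ij.2) := by
    rw [span_genLie]; trivial
  have hb : ∀ i, genLie K i 0 ∈
      Submodule.span (MvPolynomial (Fin 6) K) (Set.range fun i => br K i 0) :=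
    fun i => Submodule.subset_span ⟨i, rfl⟩
  induction hu using Submodule.span_induction with
  | mem x hx =>
    obtain ⟨⟨i, j⟩, rfl⟩ := hx
    rw [X_smul_genLie]
    exact sub_mem (Submodule.smul_mem _ _ (hb i)) (Submodule.smul_mem _ _ (hb j))
  | zero => rw [smul_zero]; exact zero_mem _
  | add x y _ _ hx hy => rw [smul_add]; exact add_mem hx hy
  | smul t x _ hx => rw [smul_comm]; exact Submodule.smul_mem _ t hx

theorem commEmb_sum_br (p : Fin 6 → MvPolynomial (Fin 6) K) {l : Fin 6} (hl : l ≠ 0) :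
    commEmb K 6 (∑ i, p i • br K i 0) l = X 0 * p l := by
  rw [map_sum, Finset.sum_apply]
  simp only [map_smul, commEmb_br]
  rw [Finset.sum_eq_single l (fun i _ hi => by simp [hi.symm, hl])
    (fun h => absurd (Finset.mem_univ _) h)]
  simp [hl, mul_comm]

theorem eq_zero_of_sum_br_eq_zero (p : Fin 6 → MvPolynomial (Fin 6) K)
    (h : ∑ i, p i • br K i 0 = 0) {l : Fin 6} (hl : l ≠ 0) : p l = 0 := by
  have h' := commEmb_sum_br K p hl
  rw [h, map_zero, Pi.zero_apply] at h'
  exact (mul_eq_zero.1 h'.symm).resolve_left (X_ne_zero 0)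

theorem commDelta_sum_br (p : Fin 6 → MvPolynomial (Fin 6) K) :
    commDelta (J222 K) (∑ i, p i • br K i 0)
      = ∑ i, ![0, polyDelta (J222 K) (p 1), polyDelta (J222 K) (p 2) + p 3,
          polyDelta (J222 K) (p 3), polyDelta (J222 K) (p 4) + p 5,
          polyDelta (J222 K) (p 5)] i • br K i 0 := by
  rw [map_sum]
  simp only [commDelta_smul, commDelta_br, Fin.sum_univ_six]
  simp [br_self]
  module

/-- For a constant `u`, the coefficients in `x₁u = ∑ i, p_i [x_i, x₁]` satisfy a triangular system of
differential equations; with `x₁[x₄, x₁] = c₇f₁ + c₁x₂ - c₄f₂` and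
`x₁[x₆, x₁] = c₈f₁ + c₂x₂ - c₄f₃` it shows that `x₁²u` is a combination of
`c₁, c₂, c₄, c₇, c₈` over the algebra of constants. Saturation removes `x₁²`. -/
theorem commConst_le_span_newElt [CharZero K] {u : Comm K 6} (hu : commDelta (J222 K) u = 0) :
    u ∈ Submodule.span K (Set.range (newElt K)) := by
  obtain ⟨p, hp⟩ := (Submodule.mem_span_range_iff_exists_fun _).1 (X_smul_mem_span_br K u)
  have h0 := commDelta_sum_br K p
  rw [hp, commDelta_smul, hu, polyDelta_X, smul_zero, zero_add] at h0
  simp only [Matrix.cons_val_zero, zero_smul] at h0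
  have hcoord := fun (l : Fin 6) (hl : l ≠ 0) => eq_zero_of_sum_br_eq_zero K _ h0.symm hl
  have d1 : polyDelta (J222 K) (p 1) = 0 := hcoord 1 (by decide)
  have d2 : polyDelta (J222 K) (p 2) + p 3 = 0 := hcoord 2 (by decide)
  have d3 : polyDelta (J222 K) (p 3) = 0 := hcoord 3 (by decide)
  have d4 : polyDelta (J222 K) (p 4) + p 5 = 0 := hcoord 4 (by decide)
  have d5 : polyDelta (J222 K) (p 5) = 0 := hcoord 5 (by decide)
  have r7 : (X 0 : MvPolynomial (Fin 6) K) • br K 3 0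
      = f1 K • c7 K + (X 1 : MvPolynomial (Fin 6) K) • c1 K - f2 K • c4 K := by
    have h := X_smul_genLie (K := K) (2 : Fin 6) 1 0
    change (X 0 : MvPolynomial (Fin 6) K) • br K 2 1 = X 1 • br K 2 0 - X 2 • br K 1 0 at h
    rw [c7, c1, c4, f1, f2, smul_sub, h]
    abel
  have r8 : (X 0 : MvPolynomial (Fin 6) K) • br K 5 0
      = f1 K • c8 K + (X 1 : MvPolynomial (Fin 6) K) • c2 K - f3 K • c4 K := by
    have h := X_smul_genLie (K := K) (4 : Fin 6) 1 0
    change (X 0 : MvPolynomial (Fin 6) K) • br K 4 1 = X 1 • br K 4 0 - X 4 • br K 1 0 at h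
    rw [c8, c2, c4, f1, f3, smul_sub, h]
    abel
  have hsq : (X 0 : MvPolynomial (Fin 6) K) • (X 0 : MvPolynomial (Fin 6) K) • u
      = (f1 K * p 1 - f2 K * p 3 - f3 K * p 5) • c4 K + (X 0 * p 2 + X 1 * p 3) • c1 K
        + (f1 K * p 3) • c7 K + (X 0 * p 4 + X 1 * p 5) • c2 K + (f1 K * p 5) • c8 K := by
    rw [← hp, Fin.sum_univ_six, br_self]
    simp only [smul_add, smul_zero, zero_add]
    rw [smul_comm (X 0) (p 3), smul_comm (X 0) (p 5), r7, r8]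
    change X 0 • p 1 • c4 K + X 0 • p 2 • c1 K + p 3 • (_ : Comm K 6) + X 0 • p 4 • c2 K
      + p 5 • (_ : Comm K 6) = _
    rw [f1]
    module
  have hf1 := f1_mem K
  have hf2 := f2_mem K
  have hf3 := f3_mem K
  have m1 : p 1 ∈ polyConst (J222 K) := d1
  have m3 : p 3 ∈ polyConst (J222 K) := d3
  have m5 : p 5 ∈ polyConst (J222 K) := d5
  have m2 : X 0 * p 2 + X 1 * p 3 ∈ polyConst (J222 K) := by
    change polyDelta (J222 K) (X 0 * p 2 + X 1 * p 3) = 0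
    rw [map_add, Derivation.leibniz, Derivation.leibniz, polyDelta_X, polyDelta_X, d3,
      eq_neg_of_add_eq_zero_left d2]
    simp
    ring
  have m4 : X 0 * p 4 + X 1 * p 5 ∈ polyConst (J222 K) := by
    change polyDelta (J222 K) (X 0 * p 4 + X 1 * p 5) = 0
    rw [map_add, Derivation.leibniz, Derivation.leibniz, polyDelta_X, polyDelta_X, d5,
      eq_neg_of_add_eq_zero_left d4]
    simp
    ring
  apply mem_span_newElt_of_X_smul_mem
  apply mem_span_newElt_of_X_smul_mem
  rw [hsq]
  refine add_mem (add_mem (add_mem (add_mem ?_ ?_) ?_) ?_) ?_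
  · exact smul_c4_mem K (sub_mem (sub_mem (mul_mem hf1 m1) (mul_mem hf2 m3)) (mul_mem hf3 m5))
  · exact smul_mem_span_newElt K m2 (cgen_mem_span_newElt K 0)
  · exact smul_c7_mem K (mul_mem hf1 m3)
  · exact smul_mem_span_newElt K m4 (cgen_mem_span_newElt K 1)
  · exact smul_c8_mem K (mul_mem hf1 m5)

theorem newElt_mem_commConst (i : CommIdx) : newElt K i ∈ commConst (J222 K) :=
  (commConst (J222 K)).smul_mem ⟨polyElt K (newIdx i).2, polyElt_mem K _⟩ (commDelta_cgen K _)

theorem span_newElt [CharZero K] : Submodule.span K (Set.range (newElt K))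
    = (commConst (J222 K)).restrictScalars K := by
  apply le_antisymm
  · rw [Submodule.span_le]
    rintro _ ⟨i, rfl⟩
    exact newElt_mem_commConst K i
  · exact fun u hu => commConst_le_span_newElt K hu

theorem range_cgen : Set.range (cgen K)
    = {c1 K, c2 K, c3 K, c4 K, c5 K, c6 K, c7 K, c8 K, c9 K, c10 K} := by
  simp only [cgen, Matrix.range_cons, Matrix.range_empty, Set.union_empty, Set.singleton_union]

theorem span_cgen [CharZero K] : Submodule.span (polyConst (J222 K)) (Set.range (cgen K))
    = commConst (J222 K) := by
  apply le_antisymm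
  · rw [Submodule.span_le]
    rintro _ ⟨j, rfl⟩
    exact commDelta_cgen K j
  · intro u hu
    have hle : Submodule.span K (Set.range (newElt K)) ≤
        (Submodule.span (polyConst (J222 K)) (Set.range (cgen K))).restrictScalars K := by
      rw [Submodule.span_le]
      rintro _ ⟨i, rfl⟩
      exact Submodule.smul_mem _ (⟨polyElt K (newIdx i).2, polyElt_mem K _⟩ : polyConst (J222 K))
        (Submodule.subset_span ⟨(newIdx i).1, rfl⟩)
    exact hle (commConst_le_span_newElt K hu)

end ConstantsOfIdeal

/-! ### Change of basis -/

section Triangular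

variable {K V ι : Type*} [Field K] [AddCommGroup V] [Module K V] {v b : ι → V} {ε : ι → K}

/-- A family that differs from a linearly independent one by nonzero factors and by a unipotent
triangular change with two steps is linearly independent. -/
theorem linearIndependent_of_triangular (hb : LinearIndependent K b)
    (hv : ∀ i, v i ≠ b i → ε i ≠ 0 ∧ v i - ε i • b i ∈ Submodule.span K (b '' {j | v j = b j})) :
    LinearIndependent K v := by
  classical
  have hex : ∀ i, ∃ (e : K) (r : ι →₀ K), e ≠ 0 ∧ v i = Finsupp.linearCombination K b
      (Finsupp.single i e + r) ∧ (∀ j, v j ≠ b j → r j = 0) ∧ (v i = b i → r = 0) := by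
    intro i
    by_cases hi : v i = b i
    · exact ⟨1, 0, one_ne_zero, by simp [hi], fun _ _ => rfl, fun _ => rfl⟩
    · obtain ⟨hε, h⟩ := hv i hi
      obtain ⟨r, hr, h⟩ := (Finsupp.mem_span_image_iff_linearCombination K).1 h
      refine ⟨ε i, r, hε, ?_, fun j hj => ?_, fun h => absurd h hi⟩
      · rw [map_add, h, Finsupp.linearCombination_single]; abel
      · by_contra hne
        exact hj (hr (Finsupp.mem_support_iff.2 hne))
  choose e r he hvr hr0 hr using hex
  rw [linearIndependent_iff]
  intro l hl
  have h0 : Finsupp.linearCombination K (fun i => Finsupp.single i (e i) + r i) l = 0 := by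
    apply (linearIndependent_iff.1 hb)
    rw [Finsupp.apply_linearCombination, ← hl]
    congr 1
    have : v = fun i => Finsupp.linearCombination K b (Finsupp.single i (e i) + r i) :=
      _root_.funext hvr
    rw [this]; rfl
  have hcoord : ∀ k, l k * e k + l.sum (fun i t => t * r i k) = 0 := by
    intro k
    have h := DFunLike.congr_fun h0 k
    rw [Finsupp.linearCombination_apply, Finsupp.sum_apply, Finsupp.zero_apply] at h
    rw [← h]
    simp only [Finsupp.smul_apply, Finsupp.add_apply, smul_eq_mul, mul_add]
    rw [Finsupp.sum_add]
    congr 1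
    rw [Finsupp.sum, Finset.sum_eq_single k (fun i _ hi => by
      rw [Finsupp.single_eq_of_ne hi.symm, mul_zero]) (fun hk => by
      rw [Finsupp.notMem_support_iff.1 hk, zero_mul]), Finsupp.single_eq_same]
  have hfst : ∀ k, v k ≠ b k → l k = 0 := by
    intro k hk
    have h := hcoord k
    rw [Finsupp.sum, Finset.sum_eq_zero (fun i _ => by rw [hr0 i k hk, mul_zero]), add_zero] at h
    exact (mul_eq_zero.1 h).resolve_right (he k)
  ext k
  have h := hcoord k
  rw [Finsupp.sum, Finset.sum_eq_zero (fun i _ => by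
    by_cases hi : v i = b i
    · rw [hr i hi, Finsupp.zero_apply, mul_zero]
    · rw [hfst i hi, zero_mul]), add_zero] at h
  exact (mul_eq_zero.1 h).resolve_right (he k)

/-- The spans of two families that differ by such a change agree. -/
theorem span_eq_of_triangular
    (hv : ∀ i, v i ≠ b i → ε i ≠ 0 ∧ v i - ε i • b i ∈ Submodule.span K (b '' {j | v j = b j})) :
    Submodule.span K (Set.range v) = Submodule.span K (Set.range b) := by
  have hb : Submodule.span K (b '' {j | v j = b j}) ≤ Submodule.span K (Set.range b) :=
    Submodule.span_mono (Set.image_subset_range _ _)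
  have hv' : Submodule.span K (b '' {j | v j = b j}) ≤ Submodule.span K (Set.range v) := by
    refine Submodule.span_mono ?_
    rintro _ ⟨j, hj, rfl⟩
    exact ⟨j, hj⟩
  have hmem : ∀ i, v i ∈ Submodule.span K (Set.range v) := fun i => Submodule.subset_span ⟨i, rfl⟩
  have hmem' : ∀ i, b i ∈ Submodule.span K (Set.range b) := fun i => Submodule.subset_span ⟨i, rfl⟩
  apply le_antisymm
  · rw [Submodule.span_le]
    rintro _ ⟨i, rfl⟩
    by_cases hi : v i = b i
    · rw [hi]; exact hmem' i
    · rw [← sub_add_cancel (v i) (ε i • b i)]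
      exact add_mem (hb (hv i hi).2) (Submodule.smul_mem _ _ (hmem' i))
  · rw [Submodule.span_le]
    rintro _ ⟨i, rfl⟩
    by_cases hi : v i = b i
    · rw [← hi]; exact hmem i
    · have h : b i = (ε i)⁻¹ • (v i - (v i - ε i • b i)) := by
        rw [sub_sub_cancel, inv_smul_smul₀ (hv i hi).1]
      rw [h]
      exact Submodule.smul_mem _ _ (sub_mem (hmem i) (hv' (hv i hi).2))

end Triangular

section ChangeOfBasis

variable (K : Type*) [Field K]

/-- The diagonal coefficients of the change from `newElt` to `commElt`. -/
def diagSign : CommIdx → K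
  | .c1a _ _ _ => -1
  | .c1b _ => -1
  | .c2b _ _ => -1
  | _ => 1

theorem commElt_c2a_zero (q1 q2 q3 : ℕ) :
    commElt K (.c2a q1 q2 q3 0) = newElt K (.c2a q1 q2 q3 0) := by
  simp [commElt, newElt, newIdx, polyElt, cgen]

theorem commElt_c4a (q1 q2 q3 q4 : ℕ) (e : Fin 2) :
    commElt K (.c4a q1 q2 q3 q4 e) = newElt K (.c4a q1 q2 q3 q4 e) := rfl

theorem commElt_c4b (q1 q3 q4 q5 : ℕ) (e : Fin 2) :
    commElt K (.c4b q1 q3 q4 q5 e) = newElt K (.c4b q1 q3 q4 q5 e) := rfl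

theorem commElt_cja (j : Fin 5) (q1 q2 q3 q4 q6 : ℕ) :
    commElt K (.cja j q1 q2 q3 q4 q6) = newElt K (.cja j q1 q2 q3 q4 q6) := by
  fin_cases j <;> rfl

theorem commElt_cjb (j : Fin 5) (q1 q3 q4 q5 q6 : ℕ) :
    commElt K (.cjb j q1 q3 q4 q5 q6) = newElt K (.cjb j q1 q3 q4 q5 q6) := by
  fin_cases j <;> rfl

theorem mono_smul_c2 (q1 q2 q3 : ℕ) :
    mono K q1 q2 q3 • c2 K = newElt K (.c2a q1 q2 q3 0) := by
  rw [← commElt_c2a_zero]; simp [commElt, mono]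

theorem mono_smul_c4 (q1 q2 q3 : ℕ) :
    mono K q1 q2 q3 • c4 K = newElt K (.c4a q1 q2 q3 0 0) := by
  rw [← commElt_c4a]; simp [commElt, mono]

theorem mono_smul_c5to9 (j : Fin 5) (q1 q2 q3 : ℕ) :
    mono K q1 q2 q3 • c5to9 K j = newElt K (.cja j q1 q2 q3 0 0) := by
  rw [← commElt_cja]; simp [commElt, mono]

/-- The second basis goes over into `commElt` by the relations for `c₁f₃`, `c₁f₆`, `c₂f₄` and
`c₂f₆`, whose remaining terms belong to both families. -/
theorem commElt_triangular [CharZero K] (i : CommIdx) (hi : commElt K i ≠ newElt K i) :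
    diagSign K i ≠ 0 ∧ commElt K i - diagSign K i • newElt K i ∈
      Submodule.span K (newElt K '' {j | commElt K j = newElt K j}) := by
  have hs : ∀ j, commElt K j = newElt K j → newElt K j ∈
      Submodule.span K (newElt K '' {j | commElt K j = newElt K j}) :=
    fun j hj => Submodule.subset_span ⟨j, hj, rfl⟩
  have s2 : ∀ q1 q2 q3, mono K q1 q2 q3 • c2 K ∈
      Submodule.span K (newElt K '' {j | commElt K j = newElt K j}) := fun q1 q2 q3 => by
    rw [mono_smul_c2]; exact hs _ (commElt_c2a_zero K q1 q2 q3)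
  have s4 : ∀ q1 q2 q3, mono K q1 q2 q3 • c4 K ∈
      Submodule.span K (newElt K '' {j | commElt K j = newElt K j}) := fun q1 q2 q3 => by
    rw [mono_smul_c4]; exact hs _ (commElt_c4a K q1 q2 q3 0 0)
  have sj : ∀ j q1 q2 q3, mono K q1 q2 q3 • c5to9 K j ∈
      Submodule.span K (newElt K '' {j | commElt K j = newElt K j}) := fun j q1 q2 q3 => by
    rw [mono_smul_c5to9]; exact hs _ (commElt_cja K j q1 q2 q3 0 0)
  refine ⟨by cases i <;> simp [diagSign], ?_⟩
  obtain ⟨r, -⟩ := generator_relations K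
  obtain ⟨-, s61, s42, s62, -, -⟩ := generator_reductions K
  rcases i with ⟨q1, q2, _ | q3⟩ | q2 | ⟨q1, q2, q3, e⟩ | ⟨q2, q3⟩ | ⟨q2, q3⟩ | ⟨q1, q2, q3, q4, e⟩ |
    ⟨q1, q3, q4, q5, e⟩ | ⟨j, q1, q2, q3, q4, q6⟩ | ⟨j, q1, q3, q4, q5, q6⟩ | _
  · exact absurd (by simp [commElt, newElt, newIdx, polyElt, cgen]) hi
  · have h : f3 K • c1 K = f2 K • c2 K - f1 K • c3 K := by rw [r]; abel
    have h1 : commElt K (.c1a q1 q2 (q3 + 1)) = mono K q1 q2 q3 • f3 K • c1 K := by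
      simp only [commElt, smul_smul, mono]; ring_nf
    have h2 : newElt K (.c1a q1 q2 (q3 + 1)) = mono K q1 q2 q3 • f1 K • c3 K := by
      rw [smul_smul, mono_mul_f1, mono_eq_polyElt]; rfl
    rw [h1, h2, h, diagSign, neg_one_smul, sub_neg_eq_add, ← smul_add, sub_add_cancel, smul_smul,
      mono_mul_f2]
    exact s2 _ _ _
  · have h1 : commElt K (.c1b q2) = mono K 0 q2 0 • f6 K • c1 K := by
      simp [commElt, smul_smul, mono]
    have h2 : newElt K (.c1b q2) = mono K 0 q2 0 • f2 K • c10 K := by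
      rw [smul_smul, mono_mul_f2, mono_eq_polyElt]; rfl
    rw [h1, h2, s61, diagSign, neg_one_smul, sub_neg_eq_add, ← smul_add]
    have h3 : mono K 0 q2 0 • (-((f2 K) • c10 K) + (f1 K * f3 K) • c5 K - (f2 K * f3 K) • c7 K
        + (f2 K ^ 2) • c8 K - (f1 K * f2 K) • c9 K + (f2 K) • c10 K)
        = mono K 1 q2 1 • c5to9 K 0 - mono K 0 (q2 + 1) 1 • c5to9 K 2
          + mono K 0 (q2 + 2) 0 • c5to9 K 3 - mono K 1 (q2 + 1) 0 • c5to9 K 4 := by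
      simp only [mono]
      change _ = _ • c5 K - _ • c7 K + _ • c8 K - _ • c9 K
      module
    rw [h3]
    exact sub_mem (add_mem (sub_mem (sj _ _ _ _) (sj _ _ _ _)) (sj _ _ _ _)) (sj _ _ _ _)
  · fin_cases e
    · exact absurd (commElt_c2a_zero K q1 q2 q3) hi
    · have h1 : commElt K (.c2a q1 q2 q3 1) = mono K q1 q2 q3 • f4 K • c2 K := by
        simp [commElt, smul_smul, mono]
      have h2 : newElt K (.c2a q1 q2 q3 1) = mono K q1 q2 q3 • f1 K • c10 K := by
        rw [smul_smul, mono_mul_f1, mono_eq_polyElt]; rfl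
      change commElt K (.c2a q1 q2 q3 1) - (1 : K) • newElt K (.c2a q1 q2 q3 1) ∈ _
      rw [h1, h2, s42, one_smul, ← smul_sub]
      have h3 : mono K q1 q2 q3 • ((f1 K) • c10 K - (f2 K * f3 K) • c4 K + (f1 K * f3 K) • c7 K
          - (f1 K) • c10 K)
          = mono K (q1 + 1) q2 (q3 + 1) • c5to9 K 2 - mono K q1 (q2 + 1) (q3 + 1) • c4 K := by
        simp only [mono]
        change _ = _ • c7 K - _
        module
      rw [h3]
      exact sub_mem (sj _ _ _ _) (s4 _ _ _)
  · have h1 : commElt K (.c2b q2 q3) = mono K 0 q2 q3 • f6 K • c2 K := by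
      simp [commElt, smul_smul, mono]
    have h2 : newElt K (.c2b q2 q3) = mono K 0 q2 q3 • f3 K • c10 K := by
      rw [smul_smul, mono_mul_f3, mono_eq_polyElt]; rfl
    rw [h1, h2, s62, diagSign, neg_one_smul, sub_neg_eq_add, ← smul_add]
    have h3 : mono K 0 q2 q3 • (-((f3 K) • c10 K) - (f1 K * f2 K) • c6 K - (f3 K ^ 2) • c7 K
        + (f2 K * f3 K) • c8 K + (f3 K) • c10 K)
        = mono K 0 (q2 + 1) (q3 + 1) • c5to9 K 3 - mono K 1 (q2 + 1) q3 • c5to9 K 1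
          - mono K 0 q2 (q3 + 2) • c5to9 K 2 := by
      simp only [mono]
      change _ = _ • c8 K - _ • c6 K - _ • c7 K
      module
    rw [h3]
    exact sub_mem (sub_mem (sj _ _ _ _) (sj _ _ _ _)) (sj _ _ _ _)
  · exact absurd (by simp [commElt, newElt, newIdx, polyElt, cgen]) hi
  · exact absurd (commElt_c4a K q1 q2 q3 q4 e) hi
  · exact absurd (commElt_c4b K q1 q3 q4 q5 e) hi
  · exact absurd (commElt_cja K j q1 q2 q3 q4 q6) hi
  · exact absurd (commElt_cjb K j q1 q3 q4 q5 q6) hi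
  · exact absurd (by simp [commElt, newElt, newIdx, polyElt, cgen]) hi

end ChangeOfBasis

end FreeMetab

end

theorem mainTheorem5 (K : Type*) [Field K] [CharZero K] :
    -- the algebra of constants of `K[X₆]`: generators, the only defining relation, a basis
    (polyConst (J222 K) =
        Algebra.adjoin K {f1 K, f2 K, f3 K, f4 K, f5 K, f6 K} ∧
      RingHom.ker (aeval (R := K) ![f1 K, f2 K, f3 K, f4 K, f5 K, f6 K]) =
        Ideal.span {(X 0 * X 5 - X 1 * X 4
          + X 2 * X 3 : MvPolynomial (Fin 6) K)} ∧
      LinearIndependent K (polyElt K) ∧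
      Submodule.span K (Set.range (polyElt K)) = Subalgebra.toSubmodule (polyConst (J222 K))) ∧
    -- the ten generators of the module of constants
    Submodule.span (polyConst (J222 K))
        {c1 K, c2 K, c3 K, c4 K, c5 K, c6 K, c7 K, c8 K, c9 K, c10 K} = commConst (J222 K) ∧
    -- the 21 relations
    ((f1 K) • c3 K = -((f3 K) • c1 K) + (f2 K) • c2 K ∧
      (f4 K) • c1 K = -((f2 K ^ 2) • c4 K) - (f1 K ^ 2) • c5 K + (f1 K * f2 K) • c7 K ∧
      (f5 K) • c1 K = -((f4 K) • c2 K) - (2 * f2 K * f3 K) • c4 K + (f1 K * f3 K) • c7 K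
        + (f1 K * f2 K) • c8 K - (f1 K ^ 2) • c9 K ∧
      (f4 K) • c3 K = -((f6 K) • c1 K) + (2 * f1 K * f3 K) • c5 K - (f2 K * f3 K) • c7 K
        + (f2 K ^ 2) • c8 K - (f1 K * f2 K) • c9 K ∧
      (f5 K) • c3 K = -((f6 K) • c2 K) - (2 * f1 K * f2 K) • c6 K - (f3 K ^ 2) • c7 K
        + (f2 K * f3 K) • c8 K + (f1 K * f3 K) • c9 K ∧
      (f6 K) • c3 K = -((f3 K ^ 2) • c5 K) - (f2 K ^ 2) • c6 K + (f2 K * f3 K) • c9 K ∧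
      (f5 K) • c2 K = -((f3 K ^ 2) • c4 K) - (f1 K ^ 2) • c6 K + (f1 K * f3 K) • c8 K ∧
      (f1 K) • c10 K = -((f5 K) • c1 K) - (f2 K * f3 K) • c4 K + (f1 K * f2 K) • c8 K
        - (f1 K ^ 2) • c9 K ∧
      (f2 K) • c10 K = -((f6 K) • c1 K) + (f1 K * f3 K) • c5 K - (f2 K * f3 K) • c7 K
        + (f2 K ^ 2) • c8 K - (f1 K * f2 K) • c9 K ∧
      (f3 K) • c10 K = -((f6 K) • c2 K) - (f1 K * f2 K) • c6 K - (f3 K ^ 2) • c7 K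
        + (f2 K * f3 K) • c8 K ∧
      (f1 K * f6 K) • c1 K = -((f2 K * f4 K) • c2 K) - (f2 K ^ 2 * f3 K) • c4 K
        + (f1 K ^ 2 * f3 K) • c5 K + (f1 K * f2 K ^ 2) • c8 K - (f1 K ^ 2 * f2 K) • c9 K ∧
      (f3 K * f6 K) • c1 K = (f2 K * f6 K) • c2 K + (f1 K * f3 K ^ 2) • c5 K
        + (f1 K * f2 K ^ 2) • c6 K - (f1 K * f2 K * f3 K) • c9 K ∧
      (f1 K * f6 K) • c2 K = -((f3 K * f4 K) • c2 K) - (f2 K * f3 K ^ 2) • c4 K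
        - (f1 K ^ 2 * f2 K) • c6 K + (f1 K * f2 K * f3 K) • c8 K ∧
      (f4 K) • c10 K = (f2 K * f6 K) • c4 K
        + (f1 K * f5 K) • c5 K - ((f1 K * f6 K + f3 K * f4 K)) • c7 K + (f2 K * f4 K) • c8 K
        - (f1 K * f4 K) • c9 K ∧
      (f5 K) • c10 K = (f3 K * f6 K) • c4 K - (f1 K * f4 K) • c6 K - (f3 K * f5 K) • c7 K
        + (f3 K * f4 K) • c8 K ∧
      (f6 K) • c10 K = -((f3 K * f5 K) • c5 K) - (f2 K * f4 K) • c6 K + (f3 K * f4 K) • c9 K ∧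
      (f6 K ^ 2) • c1 K = (f3 K * (f3 K * f4 K + 2 * f1 K * f6 K)) • c5 K
        + (f2 K ^ 2 * f4 K) • c6 K - (f2 K * f3 K * f6 K) • c7 K + (f2 K ^ 2 * f6 K) • c8 K
        - (f2 K * (f3 K * f4 K + f1 K * f6 K)) • c9 K ∧
      (f4 K ^ 2) • c2 K = (f2 K * (-f3 K * f4 K + f1 K * f6 K)) • c4 K
        + (f1 K ^ 2 * f5 K) • c5 K - (f1 K ^ 2 * f6 K) • c7 K + (f1 K * f2 K * f4 K) • c8 K
        - (f1 K ^ 2 * f4 K) • c9 K ∧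
      (f4 K * f6 K) • c2 K = -((f2 K * f3 K * f6 K) • c4 K) - (f1 K * f3 K * f5 K) • c5 K
        - (f1 K * f2 K * f4 K) • c6 K + (f1 K * f3 K * f6 K) • c7 K
        + (f1 K * f3 K * f4 K) • c9 K ∧
      (f6 K ^ 2) • c2 K = (f3 K ^ 2 * f5 K) • c5 K + (f2 K * (f3 K * f4 K - f1 K * f6 K)) • c6 K
        - (f3 K ^ 2 * f6 K) • c7 K + (f2 K * f3 K * f6 K) • c8 K - (f3 K ^ 2 * f4 K) • c9 K ∧
      (f6 K ^ 2) • c4 K = -((f5 K ^ 2) • c5 K) - (f4 K ^ 2) • c6 K + (f5 K * f6 K) • c7 K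
        - (f4 K * f6 K) • c8 K + (f4 K * f5 K) • c9 K) ∧
    -- the explicit spanning set is a basis
    LinearIndependent K (commElt K) ∧
    Submodule.span K (Set.range (commElt K)) = (commConst (J222 K)).restrictScalars K := by
  refine ⟨⟨?_, ker_aeval_fgen K, linearIndependent_polyElt K, span_polyElt_eq_polyConst K⟩, ?_,
    generator_relations K,
    linearIndependent_of_triangular (linearIndependent_newElt K) (commElt_triangular K), ?_⟩
  · rw [polyConst_eq_adjoin, range_fgen]
  · rw [← range_cgen, span_cgen]
  · rw [span_eq_of_triangular (commElt_triangular K), span_newElt]
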